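/- Let $\mathbb{K}$ be $\mathbb{R}$ or $\mathbb{C}$ and let $m\ge 1$. For Banach spaces $E_1,\dots,E_m,F$ over $\mathbb{K}$ and a continuous $m$-linear map $T:E_1\times\dots\times E_m\to F$, let $\pi_1(T)\in[0,\infty]$ be the multiple $1$-summing norm of $T$, that is, the infimum of all constants $C\geq 0$ such that for all finite sequences $(x^i_{j})_{j=1}^{J_i}\subset E_i$, $i=1,\dots,m$, $$\sum_{j_1,\dots,j_m}\|T(x^1_{j_1},\dots,x^m_{j_m})\|_F\le C\prod_{i=1}^m w_1\big((x^i_{j})_{j}\big),\qquad w_1\big((y_j)_j\big)=\sup\Big\{\sum_j|\gamma(y_j)| : \gamma\in E',\ \|\gamma\|\le 1\Big\}$$ (with $E$ the space containing the $y_j$ and $E'$ its dual). For $1\le r\le\infty$ and $1\le q\le\infty$ let $\Phi_N:\ell_r^N\times\dots\times\ell_r^N\to\ell_q^N$ be the $m$-linear map $\Phi_N(x^1,\dots,x^m)=\sum_{k=1}^N x^1_k\cdots x^m_k\,e_k$. The limit order $\lambda_m(\Pi_1,r,q)$ of the multiple $1$-summing operators is the infimum of all real $\lambda\ge 0$ for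 which there is a constant $C>0$ with $\pi_1(\Phi_N)\le C N^\lambda$ for every $N\ge1$. Let $r'$ be the conjugate exponent of $r$, $\frac1r+\frac1{r'}=1$. **Proposition.** Let $1\le r\le\infty$ and $1\le q\le 2$. Then $$\lambda_m(\Pi_1,r,q)=\begin{cases}\frac1q & \text{if } q\le r'\le 2,\\[2pt] \frac1{r'} & \text{if } r'\le q\le 2,\\[2pt] \frac1q+\frac m2-\frac mr & \text{if } \frac{2mq}{2+mq}<r\le 2,\\[2pt] 0 & \text{if } 1\le r\le\frac{2mq}{2+mq}.\end{cases}$$ -/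

import Mathlib

open scoped ENNReal NNReal

noncomputable section

/-- The weak `p`-norm `w_p(y) = sup { (∑ j, |γ (y j)| ^ p) ^ (1 / p) : γ ∈ B_{E'} }` of a finite
sequence of vectors. -/
def weakSeqNorm (𝕜 : Type*) [RCLike 𝕜] {E : Type*} [NormedAddCommGroup E] [NormedSpace 𝕜 E]
    (p : ℝ) {J : ℕ} (y : Fin J → E) : ℝ≥0∞ :=
  ⨆ (γ : E →L[𝕜] 𝕜) (_ : ‖γ‖ ≤ 1), (∑ j, ‖γ (y j)‖ₑ ^ p) ^ (1 / p)

/-- `C` is an admissible constant in the definition of multiple `p`-summing operators: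
`(∑_{j₁, …, jₘ} ‖T (x¹_{j₁}, …, xᵐ_{jₘ})‖ ^ p) ^ (1 / p) ≤ C * w_p(x¹) ⋯ w_p(xᵐ)`
for all finite sequences `x¹, …, xᵐ`, of arbitrary lengths `J 1, …, J m`. -/
def IsMultipleSummingBound {𝕜 : Type*} [RCLike 𝕜] {m : ℕ} {E : Fin m → Type*} {F : Type*}
    [∀ i, NormedAddCommGroup (E i)] [∀ i, NormedSpace 𝕜 (E i)]
    [NormedAddCommGroup F] [NormedSpace 𝕜 F]
    (p : ℝ) (T : ContinuousMultilinearMap 𝕜 E F) (C : ℝ≥0) : Prop :=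
  ∀ (J : Fin m → ℕ) (x : ∀ i, Fin (J i) → E i),
    (∑ j : (∀ i, Fin (J i)), ‖T (fun i => x i (j i))‖ₑ ^ p) ^ (1 / p)
      ≤ (C : ℝ≥0∞) * ∏ i, weakSeqNorm 𝕜 p (x i)

/-- The multiple `p`-summing norm `π_p(T)`, the infimum of the admissible constants; its value is
`∞` exactly when `T` is not multiple `p`-summing. -/
def multipleSummingNorm {𝕜 : Type*} [RCLike 𝕜] {m : ℕ} {E : Fin m → Type*} {F : Type*}
    [∀ i, NormedAddCommGroup (E i)] [∀ i, NormedSpace 𝕜 (E i)]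
    [NormedAddCommGroup F] [NormedSpace 𝕜 F]
    (p : ℝ) (T : ContinuousMultilinearMap 𝕜 E F) : ℝ≥0∞ :=
  ⨅ (C : ℝ≥0) (_ : IsMultipleSummingBound p T C), (C : ℝ≥0∞)

/-- The diagonal `m`-linear map `Φ_N : ℓ_r^N × ⋯ × ℓ_r^N → ℓ_q^N`,
`Φ_N(x¹, …, xᵐ) = ∑ k, x¹_k ⋯ xᵐ_k e_k`. -/
def diagonalMap (𝕜 : Type*) [RCLike 𝕜] (m N : ℕ) (r q : ℝ≥0∞)
    [Fact (1 ≤ r)] [Fact (1 ≤ q)] :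
    ContinuousMultilinearMap 𝕜 (fun _ : Fin m => PiLp r (fun _ : Fin N => 𝕜))
      (PiLp q (fun _ : Fin N => 𝕜)) where
  toFun x := WithLp.toLp q (fun k => ∏ i, x i k)
  map_update_add' := by
    intro _ x i a b
    ext k
    have h : ∀ c : PiLp r (fun _ : Fin N => 𝕜),
        ∏ j, Function.update x i c j k = c k * ∏ j ∈ Finset.univ.erase i, x j k := by
      intro c
      rw [← Finset.mul_prod_erase _ _ (Finset.mem_univ i), Function.update_self]
      congr 1
      refine Finset.prod_congr rfl fun j hj => ?_
      rw [Function.update_of_ne (Finset.ne_of_mem_erase hj)]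
    have hd := Subsingleton.elim ‹DecidableEq (Fin m)› (instDecidableEqFin m)
    subst hd
    simp only [PiLp.add_apply, h, add_mul]
  map_update_smul' := by
    intro _ x i c a
    ext k
    have h : ∀ c : PiLp r (fun _ : Fin N => 𝕜),
        ∏ j, Function.update x i c j k = c k * ∏ j ∈ Finset.univ.erase i, x j k := by
      intro c
      rw [← Finset.mul_prod_erase _ _ (Finset.mem_univ i), Function.update_self]
      congr 1
      refine Finset.prod_congr rfl fun j hj => ?_
      rw [Function.update_of_ne (Finset.ne_of_mem_erase hj)]
    have hd := Subsingleton.elim ‹DecidableEq (Fin m)› (instDecidableEqFin m)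
    subst hd
    simp only [PiLp.smul_apply, h, smul_eq_mul, mul_assoc]
  cont := by
    refine (PiLp.continuous_toLp q (fun _ : Fin N => 𝕜)).comp ?_
    fun_prop

/-- The limit order `λ_m(Π_p, r, q)` over the field `𝕜`: the infimum of all real `l ≥ 0` such that
`π_p(Φ_N) ≤ C * N ^ l` for some `C > 0` and all `N ≥ 1`.  The infimum is taken in the extended
reals, so that it would be `∞` if there were no such `l`. -/
def limitOrder (𝕜 : Type*) [RCLike 𝕜] (p : ℝ) (m : ℕ) (r q : ℝ≥0∞)
    [Fact (1 ≤ r)] [Fact (1 ≤ q)] : EReal :=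
  sInf ((fun l : ℝ => (l : EReal)) '' {l : ℝ | 0 ≤ l ∧ ∃ C : ℝ, 0 < C ∧ ∀ N : ℕ, 1 ≤ N →
    multipleSummingNorm p (diagonalMap 𝕜 m N r q) ≤ ENNReal.ofReal (C * (N : ℝ) ^ l)})

end

/-! Write `c x` for the coordinatewise product, `W` for the weak norm of a sequence `x_j` in
`ℓ_r^N`, and `δ = 1/r - 1/2`. Averaging the functionals with coefficients `± c_k` and using
Khinchin's inequality gives `∑_j ‖c x_j‖_2 ≤ (9/5) ‖c‖_{r'} W` for every multiplier `c`
(`sum_sqrt_le_weakSeqNorm`).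

The upper bounds turn this into a dominating vector `f`, meaning `∑_j ‖c x_j‖_q ≤ ‖c f‖_q` for all
`c`. Because `c` is arbitrary, dominating vectors of the `m` variables can be multiplied
(`sum_realLpNorm_mul_prod_le`), so that only `‖f¹ ⋯ fᵐ‖_q` has to be estimated.

For `r < 2`, a Maurey-type change of weights (`exists_weights_of_sum_sqrt_le`) and the duality
between `ℓ_{r'/2}` and `ℓ_{1/(2δ)}` give `f` in `ℓ_{1/δ}` with norm at most `2 W`, valid for all `1
≤ q ≤ 2`. Hölder's inequality then yields the exponent `max(0, 1/q - mδ)`.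

For `r ≥ 2`, random multipliers with a truncated `r'`-Pareto law upgrade the `ℓ_2`-valued estimate
to an `ℓ_{r'}`-valued one (`sum_realLpNorm_mul_le_of_sum_sqrt_le`). In `ℓ_{r'}` a constant vector
dominates, at the cost of a power of `log N`, which the limit order ignores. Comparing `ℓ_q` with
`ℓ_{r'}` gives `max(1/q, 1/r')`.

For the lower bounds, all sign vectors in every variable give `1/q - m max(0, δ)`. When `r ≥ 2`,
unit vectors in one variable and sign vectors in the others give `1/r'`. -/

/-! ### Khinchin's inequality from second and fourth moments -/

/-- The real sign attached to a boolean. -/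
def boolSign (b : Bool) : ℝ := if b then 1 else -1

lemma abs_boolSign (b : Bool) : |boolSign b| = 1 := by
  cases b <;> simp [boolSign]

/-- With `p = ‖a + b‖` and `m = ‖a - b‖`, write `2 (p⁴ + m⁴) = (p² + m²)² + (p² - m²)²`. The first
square is given by the parallelogram law and the second is at most `(4 ‖a‖ ‖b‖)²` by triangle
inequalities, so real and complex scalars are treated alike. -/
lemma norm_add_pow_four_add_norm_sub_pow_four_le {𝕜 : Type*} [RCLike 𝕜] (a b : 𝕜) :
    ‖a + b‖ ^ 4 + ‖a - b‖ ^ 4 ≤ 2 * (‖a‖ ^ 4 + 6 * ‖a‖ ^ 2 * ‖b‖ ^ 2 + ‖b‖ ^ 4) := by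
  have h := parallelogram_law_with_norm 𝕜 a b
  have h1 := norm_add_le a b
  have h2 := norm_sub_le a b
  have h3 := abs_norm_sub_norm_le a b
  have h4 := abs_norm_sub_norm_le a (-b)
  rw [sub_neg_eq_add, norm_neg] at h4
  set p := ‖a + b‖
  set m := ‖a - b‖
  set x := ‖a‖
  set y := ‖b‖
  have hp : 0 ≤ p := norm_nonneg _
  have hm : 0 ≤ m := norm_nonneg _
  have hx : 0 ≤ x := norm_nonneg _
  have hy : 0 ≤ y := norm_nonneg _
  have h5 : p ^ 2 - m ^ 2 ≤ 4 * (x * y) := by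
    have := pow_le_pow_left₀ hp h1 2
    have := pow_le_pow_left₀ (abs_nonneg _) h3 2
    rw [sq_abs] at this
    nlinarith
  have h6 : m ^ 2 - p ^ 2 ≤ 4 * (x * y) := by
    have := pow_le_pow_left₀ hm h2 2
    have := pow_le_pow_left₀ (abs_nonneg _) h4 2
    rw [sq_abs] at this
    nlinarith
  have h7 : (p ^ 2 - m ^ 2) ^ 2 ≤ (4 * (x * y)) ^ 2 := sq_le_sq' (by linarith) h5
  have h8 : p ^ 2 + m ^ 2 = 2 * (x ^ 2 + y ^ 2) := by nlinarith
  have h9 : (p ^ 2 + m ^ 2) ^ 2 = (2 * (x ^ 2 + y ^ 2)) ^ 2 := by rw [h8]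
  nlinarith

/-- Splitting a sum over sign patterns along the first sign. -/
lemma sum_sign_pattern_succ {M : Type*} [AddCommMonoid M] {N : ℕ} (F : (Fin (N + 1) → Bool) → M) :
    ∑ e, F e = ∑ e : Fin N → Bool, (F (Fin.cons true e) + F (Fin.cons false e)) := by
  rw [← (Fin.consEquiv (fun _ : Fin (N + 1) => Bool)).sum_comp, Fintype.sum_prod_type]
  simp only [Fintype.sum_bool, Finset.sum_add_distrib]
  rfl

lemma sum_norm_signed_sum_sq {𝕜 : Type*} [RCLike 𝕜] {N : ℕ} (z : Fin N → 𝕜) :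
    ∑ e : Fin N → Bool, ‖∑ k, (boolSign (e k) : 𝕜) * z k‖ ^ 2 = 2 ^ N * ∑ k, ‖z k‖ ^ 2 := by
  induction N with
  | zero => simp
  | succ N ih =>
    have h := ih (fun k => z k.succ)
    rw [sum_sign_pattern_succ, Fin.sum_univ_succ (fun k => ‖z k‖ ^ 2)]
    have : ∀ e : Fin N → Bool,
        ‖∑ k, (boolSign ((Fin.cons true e : Fin (N + 1) → Bool) k) : 𝕜) * z k‖ ^ 2 +
        ‖∑ k, (boolSign ((Fin.cons false e : Fin (N + 1) → Bool) k) : 𝕜) * z k‖ ^ 2 =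
        2 * (‖z 0‖ ^ 2 + ‖∑ k, (boolSign (e k) : 𝕜) * z k.succ‖ ^ 2) := by
      intro e
      simp only [Fin.sum_univ_succ, Fin.cons_zero, Fin.cons_succ]
      set s := ∑ k, (boolSign (e k) : 𝕜) * z k.succ
      have := parallelogram_law_with_norm 𝕜 (z 0) s
      have h2 : ‖-z 0 + s‖ = ‖z 0 - s‖ := by rw [← norm_neg]; congr 1; ring
      simp only [boolSign, if_true, Bool.false_eq_true, if_false, RCLike.ofReal_one, one_mul,
        RCLike.ofReal_neg, neg_mul, h2]
      nlinarith
    simp_rw [this]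
    rw [← Finset.mul_sum, Finset.sum_add_distrib, h]
    simp only [Finset.sum_const, Finset.card_univ, Fintype.card_pi, Fintype.card_bool,
      Finset.prod_const, Fintype.card_fin, nsmul_eq_mul]
    push_cast
    ring

lemma sum_norm_signed_sum_pow_four_le {𝕜 : Type*} [RCLike 𝕜] {N : ℕ} (z : Fin N → 𝕜) :
    ∑ e : Fin N → Bool, ‖∑ k, (boolSign (e k) : 𝕜) * z k‖ ^ 4
      ≤ 2 ^ N * (3 * (∑ k, ‖z k‖ ^ 2) ^ 2) := by
  induction N with
  | zero => simp
  | succ N ih =>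
    have h := ih (fun k => z k.succ)
    have hsq := sum_norm_signed_sum_sq (fun k => z k.succ)
    rw [sum_sign_pattern_succ, Fin.sum_univ_succ (fun k => ‖z k‖ ^ 2)]
    have : ∀ e : Fin N → Bool,
        ‖∑ k, (boolSign ((Fin.cons true e : Fin (N + 1) → Bool) k) : 𝕜) * z k‖ ^ 4 +
        ‖∑ k, (boolSign ((Fin.cons false e : Fin (N + 1) → Bool) k) : 𝕜) * z k‖ ^ 4 ≤
        2 * ‖z 0‖ ^ 4 + 12 * ‖z 0‖ ^ 2 * ‖∑ k, (boolSign (e k) : 𝕜) * z k.succ‖ ^ 2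
          + 2 * ‖∑ k, (boolSign (e k) : 𝕜) * z k.succ‖ ^ 4 := by
      intro e
      simp only [Fin.sum_univ_succ, Fin.cons_zero, Fin.cons_succ]
      set s := ∑ k, (boolSign (e k) : 𝕜) * z k.succ
      have := norm_add_pow_four_add_norm_sub_pow_four_le (z 0) s
      have h2 : ‖-z 0 + s‖ = ‖z 0 - s‖ := by rw [← norm_neg]; congr 1; ring
      simp only [boolSign, if_true, Bool.false_eq_true, if_false, RCLike.ofReal_one, one_mul,
        RCLike.ofReal_neg, neg_mul, h2]
      linarith
    refine (Finset.sum_le_sum fun e _ => this e).trans ?_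
    rw [Finset.sum_add_distrib, Finset.sum_add_distrib, ← Finset.mul_sum, ← Finset.mul_sum, hsq,
      ← Finset.mul_sum]
    simp only [Finset.sum_const, Finset.card_univ, Fintype.card_pi, Fintype.card_bool,
      Finset.prod_const, Fintype.card_fin, nsmul_eq_mul]
    push_cast
    have h0 : (0 : ℝ) ≤ 2 ^ N * ‖z 0‖ ^ 4 := by positivity
    rw [pow_succ (2 : ℝ) N]
    nlinarith

/-- Khinchin's inequality between the first and the second moment. -/
lemma sqrt_sum_sq_le_sum_norm_signed_sum {𝕜 : Type*} [RCLike 𝕜] {N : ℕ} (z : Fin N → 𝕜) :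
    2 ^ N * √(∑ k, ‖z k‖ ^ 2)
      ≤ 9 / 5 * ∑ e : Fin N → Bool, ‖∑ k, (boolSign (e k) : 𝕜) * z k‖ := by
  have h2 := sum_norm_signed_sum_sq z
  have h4 := sum_norm_signed_sum_pow_four_le z
  have hs : 0 ≤ ∑ k, ‖z k‖ ^ 2 := by positivity
  set S := √(∑ k, ‖z k‖ ^ 2) with hS
  have hSS : ∑ k, ‖z k‖ ^ 2 = S ^ 2 := (Real.sq_sqrt hs).symm
  rw [hSS] at h2 h4
  rcases (Real.sqrt_nonneg (∑ k, ‖z k‖ ^ 2)).eq_or_lt with h0 | h0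
  · rw [hS, ← h0]
    simp only [mul_zero]
    positivity
  rw [← hS] at h0
  -- A quartic minorant of `S³ t`: the difference is `(4/27) t (t - 3S/2)² (t + 3S)`. Summing over
  -- signs and inserting both moments leaves the factor `1 - 3 · 4/27 = 5/9`.
  have key : ∀ t : ℝ, 0 ≤ t → S ^ 2 * t ^ 2 - 4 / 27 * t ^ 4 ≤ S ^ 3 * t := by
    intro t ht
    have : 0 ≤ 4 / 27 * t * ((t - 3 / 2 * S) ^ 2 * (t + 3 * S)) := by positivity
    nlinarith
  have := Finset.sum_le_sum fun (e : Fin N → Bool) (_ : e ∈ Finset.univ) =>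
    key ‖∑ k, (boolSign (e k) : 𝕜) * z k‖ (norm_nonneg _)
  rw [Finset.sum_sub_distrib, ← Finset.mul_sum, ← Finset.mul_sum, ← Finset.mul_sum, h2] at this
  have h3 : 0 < S ^ 3 := by positivity
  refine le_of_mul_le_mul_left ?_ h3
  nlinarith

/-! ### Finite-dimensional `ℓ_q` norms -/

/-- The `ℓ_q` norm of a real vector. -/
noncomputable def realLpNorm {ι : Type*} [Fintype ι] (q : ℝ) (f : ι → ℝ) : ℝ :=
  (∑ k, |f k| ^ q) ^ q⁻¹

lemma realLpNorm_nonneg {ι : Type*} [Fintype ι] (q : ℝ) (f : ι → ℝ) : 0 ≤ realLpNorm q f := by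
  unfold realLpNorm; positivity

lemma realLpNorm_rpow {ι : Type*} [Fintype ι] {q : ℝ} (hq : q ≠ 0) (f : ι → ℝ) :
    realLpNorm q f ^ q = ∑ k, |f k| ^ q := by
  unfold realLpNorm
  rw [← Real.rpow_mul (by positivity), inv_mul_cancel₀ hq, Real.rpow_one]

lemma realLpNorm_two {ι : Type*} [Fintype ι] (f : ι → ℝ) :
    realLpNorm 2 f = √(∑ k, f k ^ 2) := by
  unfold realLpNorm
  rw [Real.sqrt_eq_rpow]
  norm_num

lemma realLpNorm_mono {ι : Type*} [Fintype ι] {q : ℝ} (hq : 0 < q) {f g : ι → ℝ}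
    (h : ∀ k, |f k| ≤ |g k|) : realLpNorm q f ≤ realLpNorm q g := by
  unfold realLpNorm
  exact Real.rpow_le_rpow (by positivity) (Finset.sum_le_sum fun k _ =>
    Real.rpow_le_rpow (abs_nonneg _) (h k) hq.le) (by positivity)

lemma realLpNorm_const_mul {ι : Type*} [Fintype ι] {q : ℝ} (hq : 0 < q) (c : ℝ) (f : ι → ℝ) :
    realLpNorm q (fun k => c * f k) = |c| * realLpNorm q f := by
  unfold realLpNorm
  simp_rw [abs_mul, Real.mul_rpow (abs_nonneg _) (abs_nonneg _)]
  rw [← Finset.mul_sum, Real.mul_rpow (by positivity) (by positivity),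
    ← Real.rpow_mul (abs_nonneg _), mul_inv_cancel₀ hq.ne', Real.rpow_one]

lemma abs_le_realLpNorm {ι : Type*} [Fintype ι] {q : ℝ} (hq : 0 < q) (f : ι → ℝ) (k : ι) :
    |f k| ≤ realLpNorm q f := by
  have h : |f k| ^ q ≤ ∑ k, |f k| ^ q :=
    Finset.single_le_sum (f := fun k => |f k| ^ q) (fun _ _ => by positivity) (Finset.mem_univ k)
  rw [← realLpNorm_rpow hq.ne'] at h
  exact (Real.rpow_le_rpow_iff (abs_nonneg _) (realLpNorm_nonneg _ _) hq).1 h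

/-- The `ℓ_q` norms are nonincreasing in `q`. -/
lemma realLpNorm_anti {ι : Type*} [Fintype ι] {p q : ℝ} (hp : 0 < p) (hpq : p ≤ q) (f : ι → ℝ) :
    realLpNorm q f ≤ realLpNorm p f := by
  have hq : 0 < q := hp.trans_le hpq
  rw [← Real.rpow_le_rpow_iff (realLpNorm_nonneg _ _) (realLpNorm_nonneg _ _) hq,
    realLpNorm_rpow hq.ne']
  have h : ∀ k, |f k| ^ q ≤ |f k| ^ p * realLpNorm p f ^ (q - p) := by
    intro k
    rcases (abs_nonneg (f k)).eq_or_lt with h0 | h0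
    · rw [← h0, Real.zero_rpow hq.ne', Real.zero_rpow hp.ne', zero_mul]
    · rw [show q = p + (q - p) by ring, Real.rpow_add h0, add_sub_cancel_left]
      gcongr
      exact abs_le_realLpNorm hp f k
  refine (Finset.sum_le_sum fun k _ => h k).trans ?_
  rw [← Finset.sum_mul, ← realLpNorm_rpow hp.ne']
  rcases (realLpNorm_nonneg p f).eq_or_lt with h0 | h0
  · rw [← h0, Real.zero_rpow hq.ne', Real.zero_rpow hp.ne', zero_mul]
  · rw [← Real.rpow_add h0, add_sub_cancel]

lemma realLpNorm_le_card_rpow_mul {ι : Type*} [Fintype ι] {p q : ℝ} (hp : 0 < p) (hpq : p ≤ q)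
    (f : ι → ℝ) :
    realLpNorm p f ≤ (Fintype.card ι : ℝ) ^ (p⁻¹ - q⁻¹) * realLpNorm q f := by
  have hq : 0 < q := hp.trans_le hpq
  have h := Real.inner_le_weight_mul_Lp_of_nonneg Finset.univ (p := q / p)
    ((one_le_div hp).2 hpq) (fun _ : ι => 1) (fun k => |f k| ^ p) (by simp)
    (fun _ => by positivity)
  simp only [one_mul, Finset.sum_const, Finset.card_univ, nsmul_eq_mul, mul_one] at h
  have h2 : ∀ k, (|f k| ^ p) ^ (q / p) = |f k| ^ q := fun k => by
    rw [← Real.rpow_mul (abs_nonneg _), mul_div_cancel₀ _ hp.ne']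
  simp_rw [h2] at h
  have h3 := Real.rpow_le_rpow (by positivity) h (inv_nonneg.2 hp.le)
  refine h3.trans_eq ?_
  unfold realLpNorm
  rw [Real.mul_rpow (by positivity) (by positivity), ← Real.rpow_mul (by positivity),
    ← Real.rpow_mul (by positivity)]
  congr 2 <;> field_simp

/-! ### Change of weights -/

/-- An averaged `ℓ_2`-type bound with weights gives a dominating vector for all `q ≤ 2`. -/
lemma sum_realLpNorm_mul_le_of_weights {ι κ : Type*} [Fintype ι] [Fintype κ] (a : ι → κ → ℝ)
    (w : ι → ℝ) (hw : ∀ i, 0 < w i) (hw1 : ∑ i, w i ≤ 1) {q : ℝ} (hq1 : 1 ≤ q) (hq2 : q ≤ 2)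
    (c : κ → ℝ) :
    ∑ i, realLpNorm q (fun k => c k * a i k)
      ≤ realLpNorm q (fun k => c k * √(∑ i, a i k ^ 2 / w i)) := by
  have hq0 : 0 < q := by linarith
  have hw0 : 0 ≤ ∑ i, w i := Finset.sum_nonneg fun i _ => (hw i).le
  have h1 : ∀ i, realLpNorm q (fun k => c k * a i k)
      = w i * realLpNorm q (fun k => c k * (a i k / w i)) := by
    intro i
    rw [← abs_of_pos (hw i), ← realLpNorm_const_mul hq0]
    congr 1
    ext k
    rw [abs_of_pos (hw i)]
    field_simp [(hw i).ne']
  -- With total mass of `w` at most one, Jensen is used twice: over `i` with exponent `q ≥ 1`, then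
  -- in each coordinate `k` with exponent `2/q ≥ 1`.
  simp_rw [h1]
  refine (Real.inner_le_weight_mul_Lp_of_nonneg Finset.univ hq1 w _ (fun i => (hw i).le)
    (fun i => realLpNorm_nonneg _ _)).trans ?_
  have h2 : (∑ i, w i) ^ (1 - q⁻¹) ≤ 1 :=
    Real.rpow_le_one hw0 hw1 (by simpa using inv_le_one_of_one_le₀ hq1)
  refine (mul_le_mul_of_nonneg_right h2 (Real.rpow_nonneg (Finset.sum_nonneg fun i _ =>
    mul_nonneg (hw i).le (Real.rpow_nonneg (realLpNorm_nonneg _ _) _)) _)).trans ?_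
  rw [one_mul]
  conv_rhs => unfold realLpNorm
  refine Real.rpow_le_rpow (Finset.sum_nonneg fun i _ =>
    mul_nonneg (hw i).le (Real.rpow_nonneg (realLpNorm_nonneg _ _) _)) ?_ (by positivity)
  simp_rw [realLpNorm_rpow hq0.ne', Finset.mul_sum]
  rw [Finset.sum_comm]
  refine Finset.sum_le_sum fun k _ => ?_
  have h3 := Real.inner_le_weight_mul_Lp_of_nonneg Finset.univ (p := 2 / q)
    ((one_le_div hq0).2 hq2) w (fun i => |a i k / w i| ^ q) (fun i => (hw i).le)
    (fun _ => by positivity)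
  have h4 : ∀ i, w i * (|a i k / w i| ^ q) ^ (2 / q) = a i k ^ 2 / w i := fun i => by
    rw [← Real.rpow_mul (abs_nonneg _), mul_div_cancel₀ _ hq0.ne', Real.rpow_two, sq_abs]
    field_simp [(hw i).ne']
  have h5 : (∑ i, w i) ^ (1 - (2 / q)⁻¹) ≤ 1 :=
    Real.rpow_le_one hw0 hw1 (by
      rw [inv_div, sub_nonneg, div_le_one (by norm_num)]; exact hq2)
  simp_rw [h4] at h3
  have h6 : 0 ≤ ∑ i, a i k ^ 2 / w i :=
    Finset.sum_nonneg fun i _ => div_nonneg (sq_nonneg _) (hw i).le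
  have h7 : |√(∑ i, a i k ^ 2 / w i)| ^ q = (∑ i, a i k ^ 2 / w i) ^ (2 / q)⁻¹ := by
    rw [abs_of_nonneg (Real.sqrt_nonneg _), Real.sqrt_eq_rpow, ← Real.rpow_mul h6]
    congr 1
    field_simp
  have h8 : ∑ i, w i * |c k * (a i k / w i)| ^ q
      = |c k| ^ q * ∑ i, w i * |a i k / w i| ^ q := by
    rw [Finset.mul_sum]
    refine Finset.sum_congr rfl fun i _ => ?_
    rw [abs_mul, Real.mul_rpow (abs_nonneg _) (abs_nonneg _)]
    ring
  rw [h8, abs_mul, Real.mul_rpow (abs_nonneg _) (abs_nonneg _), h7]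
  refine mul_le_mul_of_nonneg_left ?_ (by positivity)
  refine h3.trans ?_
  exact mul_le_of_le_one_left (Real.rpow_nonneg h6 _) h5

/-- First-order expansion of the square root with an explicit quadratic error, which replaces
differentiation in the variational argument below. Scaling reduces it to `1 + u/2 - u²/2 ≤ √(1 +
u)`. -/
lemma sub_sq_le_sqrt_sq_add {s y : ℝ} (hs : 0 < s) (hy : 0 ≤ s ^ 2 + y) :
    s + y / (2 * s) - y ^ 2 / (2 * s ^ 3) ≤ √(s ^ 2 + y) := by
  obtain ⟨u, rfl⟩ : ∃ u, y = u * s ^ 2 := ⟨y / s ^ 2, by field_simp⟩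
  have h1 : s + u * s ^ 2 / (2 * s) - (u * s ^ 2) ^ 2 / (2 * s ^ 3)
      = s * (1 + u / 2 - u ^ 2 / 2) := by field_simp
  have h2 : s ^ 2 + u * s ^ 2 = s ^ 2 * (1 + u) := by ring
  rw [h2] at hy
  have hu : 0 ≤ 1 + u := by
    by_contra! h
    nlinarith [pow_pos hs 2]
  rw [h1, h2, Real.sqrt_mul (sq_nonneg s), Real.sqrt_sq hs.le]
  refine mul_le_mul_of_nonneg_left ?_ hs.le
  by_cases hR : 1 + u / 2 - u ^ 2 / 2 ≤ 0
  · exact hR.trans (Real.sqrt_nonneg _)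
  · push Not at hR
    refine Real.le_sqrt_of_sq_le ?_
    have h3 : 0 ≤ 3 - u := by nlinarith
    have : 0 ≤ u ^ 2 * ((1 + u) * (3 - u)) := by positivity
    nlinarith

/-- A Maurey-type change of weights: a bound for `∑ i, ‖a i‖_{L²(d)}`, uniform over a compact convex
set of densities `d`, comes from one bound for a weighted sum of squares. -/
lemma exists_weights_of_sum_sqrt_le {ι κ : Type*} [Fintype ι] [Fintype κ] (a : ι → κ → ℝ)
    {D : Set (κ → ℝ)} (hD : IsCompact D) (hconv : Convex ℝ D) (hne : D.Nonempty)
    (hpos : ∀ d ∈ D, ∀ k, 0 ≤ d k) {M M' : ℝ} (hMM : M < M')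
    (h : ∀ d ∈ D, ∑ i, √(∑ k, d k * a i k ^ 2) ≤ M) :
    ∃ w : ι → ℝ, (∀ i, 0 < w i) ∧ ∑ i, w i ≤ 1 ∧
      ∀ d ∈ D, ∑ k, d k * ∑ i, a i k ^ 2 / w i ≤ M' ^ 2 := by
  set A : ι → (κ → ℝ) → ℝ := fun i d => ∑ k, d k * a i k ^ 2 with hA
  have hA0 : ∀ i, ∀ d ∈ D, 0 ≤ A i d := fun i d hd =>
    Finset.sum_nonneg fun k _ => mul_nonneg (hpos d hd k) (sq_nonneg _)
  set n : ℝ := (Fintype.card ι : ℝ) with hn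
  have hn0 : 0 ≤ n := Nat.cast_nonneg _
  -- The slack `M' - M` pays for replacing each `√(A i d)` by `√(t² + A i d)`, which is bounded away
  -- from zero. The `n + 1` covers an empty index set.
  set t : ℝ := (M' - M) / (n + 1) with ht
  have ht0 : 0 < t := div_pos (by linarith) (by positivity)
  have htn : n * t ≤ M' - M := by
    have : (n + 1) * t = M' - M := by rw [ht]; field_simp
    nlinarith
  have hM' : 0 < M' := by
    obtain ⟨d, hd⟩ := hne
    exact (Finset.sum_nonneg fun i _ => Real.sqrt_nonneg _).trans_lt ((h d hd).trans_lt hMM)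
  have hAc : ∀ i, Continuous (A i) := fun i => by
    simp only [hA]
    fun_prop
  have hcont : ContinuousOn (fun d => ∑ i, √(t ^ 2 + A i d)) D := by
    refine Continuous.continuousOn ?_
    fun_prop
  obtain ⟨d₀, hd₀, hmax⟩ := hD.exists_isMaxOn hne hcont
  set s : ι → ℝ := fun i => √(t ^ 2 + A i d₀) with hs
  have hs2 : ∀ i, s i ^ 2 = t ^ 2 + A i d₀ := fun i =>
    Real.sq_sqrt (by have := hA0 i d₀ hd₀; positivity)
  have hs0 : ∀ i, 0 < s i := fun i =>
    Real.sqrt_pos.2 (by have := hA0 i d₀ hd₀; positivity)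
  have hsum : ∑ i, s i ≤ M' := by
    have h1 : ∀ i, s i ≤ t + √(A i d₀) := by
      intro i
      have := hA0 i d₀ hd₀
      refine Real.sqrt_le_iff.2 ⟨by positivity, ?_⟩
      have h2 := Real.sq_sqrt this
      nlinarith [mul_nonneg ht0.le (Real.sqrt_nonneg (A i d₀))]
    refine (Finset.sum_le_sum fun i _ => h1 i).trans ?_
    rw [Finset.sum_add_distrib]
    have h3 := h d₀ hd₀
    simp only [Finset.sum_const, Finset.card_univ, nsmul_eq_mul]
    linarith
  -- First-order optimality of the maximizer `d₀`: moving from `d₀` towards `d` by `u` cannot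
  -- increase the sum of square roots, so the linear term `X` is at most `u * Y` for every small
  -- `u`.
  have hvar : ∀ d ∈ D, ∑ i, (A i d - A i d₀) / s i ≤ 0 := by
    intro d hd
    set B : ι → ℝ := fun i => A i d - A i d₀ with hB
    set X := ∑ i, B i / s i with hX
    set Y := ∑ i, B i ^ 2 / s i ^ 3 with hY
    have hstep : ∀ u : ℝ, 0 < u → u ≤ 1 → X ≤ u * Y := by
      intro u hu0 hu1
      have hmem : d₀ + u • (d - d₀) ∈ D := hconv.add_smul_sub_mem hd₀ hd ⟨hu0.le, hu1⟩
      have hlin : ∀ i, A i (d₀ + u • (d - d₀)) = A i d₀ + u * B i := by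
        intro i
        simp only [hB, hA, Pi.add_apply, Pi.smul_apply, Pi.sub_apply, smul_eq_mul]
        rw [← Finset.sum_sub_distrib, Finset.mul_sum, ← Finset.sum_add_distrib]
        exact Finset.sum_congr rfl fun k _ => by ring
      have h1 : ∑ i, √(t ^ 2 + A i (d₀ + u • (d - d₀))) ≤ ∑ i, s i := hmax hmem
      have h2 : ∀ i, s i + (u * B i) / (2 * s i) - (u * B i) ^ 2 / (2 * s i ^ 3)
          ≤ √(t ^ 2 + A i (d₀ + u • (d - d₀))) := by
        intro i
        have h3 : s i ^ 2 + u * B i = t ^ 2 + A i (d₀ + u • (d - d₀)) := by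
          rw [hs2, hlin]; ring
        rw [← h3]
        refine sub_sq_le_sqrt_sq_add (hs0 i) ?_
        rw [h3]
        have := hA0 i _ hmem
        positivity
      have h4 := (Finset.sum_le_sum fun i (_ : i ∈ Finset.univ) => h2 i).trans h1
      have h5 : ∑ i, (s i + (u * B i) / (2 * s i) - (u * B i) ^ 2 / (2 * s i ^ 3))
          = ∑ i, s i + u / 2 * (X - u * Y) := by
        rw [hX, hY, Finset.mul_sum, ← Finset.sum_sub_distrib, Finset.mul_sum,
          ← Finset.sum_add_distrib]
        refine Finset.sum_congr rfl fun i _ => ?_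
        have := (hs0 i).ne'
        field_simp
        ring
      rw [h5] at h4
      have h6 : u / 2 * (X - u * Y) ≤ 0 := by linarith
      have h7 : X - u * Y ≤ 0 := by
        by_contra! h8
        have : 0 < u / 2 * (X - u * Y) := by positivity
        linarith
      linarith
    by_contra! hX0
    have hXY := hstep 1 one_pos le_rfl
    rw [one_mul] at hXY
    have hY0 : 0 < Y := hX0.trans_le hXY
    have := hstep (X / (2 * Y)) (by positivity)
      ((div_le_one (by positivity)).2 (by linarith))
    have h9 : X / (2 * Y) * Y = X / 2 := by field_simp
    linarith
  -- The weights are the normalized terms at the maximizer. By optimality `∑ A i d / s i` is largest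
  -- at `d₀`, where it is at most `∑ s i ≤ M'`.
  refine ⟨fun i => s i / M', fun i => div_pos (hs0 i) hM', ?_, fun d hd => ?_⟩
  · rw [← Finset.sum_div]
    exact (div_le_one hM').2 hsum
  · have h1 : ∑ k, d k * ∑ i, a i k ^ 2 / (s i / M') = M' * ∑ i, A i d / s i := by
      simp only [hA, Finset.mul_sum, Finset.sum_div]
      rw [Finset.sum_comm]
      refine Finset.sum_congr rfl fun i _ => Finset.sum_congr rfl fun k _ => ?_
      have := (hs0 i).ne'
      field_simp
    have h2 := hvar d hd
    simp_rw [sub_div] at h2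
    rw [Finset.sum_sub_distrib] at h2
    have h3 : ∑ i, A i d₀ / s i ≤ ∑ i, s i := Finset.sum_le_sum fun i _ => by
      rw [div_le_iff₀ (hs0 i), ← sq, hs2]
      nlinarith
    rw [h1]
    nlinarith

/-! ### Randomization by truncated Pareto variables -/

/-- For independent uniform `u k`, the `k`-th condition has probability at most `1 - θ k + 1/(2N) ≤
exp(1/(2N) - θ k)`. The product is at most `exp(-1/2) ≤ 2/3`. -/
lemma card_filter_forall_lt_le {N : ℕ} (hN : 1 ≤ N) (θ : Fin N → ℝ) (h0 : ∀ k, 0 ≤ θ k)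
    (h1 : ∑ k, θ k = 1) :
    ((Finset.univ.filter (fun u : Fin N → Fin (2 * N) =>
      ∀ k, 2 * (N : ℝ) * θ k < (u k : ℕ) + 1)).card : ℝ) ≤ 2 / 3 * (2 * (N : ℝ)) ^ N := by
  have hNr : (1 : ℝ) ≤ N := by exact_mod_cast hN
  set M : ℝ := 2 * (N : ℝ) with hM
  have hM0 : 0 < M := by positivity
  have hfil : Finset.univ.filter (fun u : Fin N → Fin (2 * N) => ∀ k, M * θ k < (u k : ℕ) + 1)
      = Fintype.piFinset (fun k => Finset.univ.filter
        (fun v : Fin (2 * N) => M * θ k < (v : ℕ) + 1)) := by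
    ext u
    simp
  have hcard : ∀ k, ((Finset.univ.filter
      (fun v : Fin (2 * N) => M * θ k < (v : ℕ) + 1)).card : ℝ)
        ≤ M * Real.exp (-(θ k - M⁻¹)) := by
    intro k
    have hθ : θ k ≤ 1 := h1 ▸ Finset.single_le_sum (fun i _ => h0 i) (Finset.mem_univ k)
    have hfl : ⌊M * θ k⌋₊ ≤ 2 * N := by
      refine Nat.floor_le_of_le ?_
      push_cast
      rw [← hM]
      nlinarith
    have h2 : (Finset.univ.filter (fun v : Fin (2 * N) => M * θ k < (v : ℕ) + 1)).card
        ≤ (Finset.Ico ⌊M * θ k⌋₊ (2 * N)).card := by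
      refine Finset.card_le_card_of_injOn (fun v => (v : ℕ)) ?_ (Fin.val_injective.injOn)
      intro v hv
      simp only [Finset.coe_filter, Finset.mem_univ, true_and, Set.mem_ofPred_eq] at hv
      simp only [Finset.coe_Ico, Set.mem_Ico]
      refine ⟨?_, v.2⟩
      have : ⌊M * θ k⌋₊ < (v : ℕ) + 1 := by
        rw [Nat.floor_lt (mul_nonneg hM0.le (h0 k))]
        exact_mod_cast hv
      omega
    rw [Nat.card_Ico] at h2
    have h3 : ((2 * N - ⌊M * θ k⌋₊ : ℕ) : ℝ) = M - ⌊M * θ k⌋₊ := by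
      rw [Nat.cast_sub hfl]; push_cast; rw [hM]
    have h4 : ((Finset.univ.filter (fun v : Fin (2 * N) => M * θ k < (v : ℕ) + 1)).card : ℝ)
        ≤ M - ⌊M * θ k⌋₊ := by
      rw [← h3]; exact_mod_cast h2
    have h5 := Nat.lt_floor_add_one (M * θ k)
    have h6 := Real.one_sub_le_exp_neg (θ k - M⁻¹)
    have h7 : M * (1 - (θ k - M⁻¹)) ≤ M * Real.exp (-(θ k - M⁻¹)) :=
      mul_le_mul_of_nonneg_left h6 hM0.le
    have h8 : M * (1 - (θ k - M⁻¹)) = M - M * θ k + 1 := by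
      field_simp
      ring
    linarith
  rw [hfil, Fintype.card_piFinset, Nat.cast_prod]
  refine (Finset.prod_le_prod (fun _ _ => Nat.cast_nonneg _) (fun k _ => hcard k)).trans ?_
  rw [Finset.prod_mul_distrib, ← Real.exp_sum, Finset.sum_neg_distrib, Finset.sum_sub_distrib, h1]
  simp only [Finset.prod_const, Finset.sum_const, Finset.card_univ, Fintype.card_fin, nsmul_eq_mul]
  have h9 : (N : ℝ) * M⁻¹ = 1 / 2 := by rw [hM]; field_simp
  rw [h9, Real.exp_neg, mul_comm]
  refine mul_le_mul_of_nonneg_right ?_ (by positivity)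
  have := Real.add_one_le_exp (1 - 1 / 2 : ℝ)
  rw [inv_le_comm₀ (Real.exp_pos _) (by norm_num)]
  linarith

/-- For independent `g k` with the discretised `ρ`-Pareto distribution, the expected `ℓ_2` norm of
`(g k * z k)` dominates the `ℓ_ρ` norm of `z`. -/
lemma pow_mul_realLpNorm_le_sum_sqrt {N : ℕ} (hN : 1 ≤ N) {ρ : ℝ} (hρ : 0 < ρ) (z : Fin N → ℝ) :
    (2 * (N : ℝ)) ^ N * realLpNorm ρ z ≤ 3 * ∑ u : Fin N → Fin (2 * N),
      √(∑ k, ((2 * (N : ℝ) / ((u k : ℕ) + 1)) ^ ρ⁻¹ * z k) ^ 2) := by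
  have hNr : (1 : ℝ) ≤ N := by exact_mod_cast hN
  rcases (realLpNorm_nonneg ρ z).eq_or_lt with ht | ht
  · rw [← ht, mul_zero]; positivity
  set t := realLpNorm ρ z with ht_def
  have htρ : 0 < t ^ ρ := Real.rpow_pos_of_pos ht _
  -- The event that every `|g k * z k|` stays below `t`. Off it a single coordinate already makes
  -- the `ℓ_2` norm at least `t`, and this happens for at least a third of all `u`.
  set bad := Finset.univ.filter (fun u : Fin N → Fin (2 * N) =>
      ∀ k, 2 * (N : ℝ) * (|z k| ^ ρ / t ^ ρ) < (u k : ℕ) + 1) with hbad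
  have hb : (bad.card : ℝ) ≤ 2 / 3 * (2 * (N : ℝ)) ^ N := by
    refine card_filter_forall_lt_le hN _ (fun k => by positivity) ?_
    rw [← Finset.sum_div, ← realLpNorm_rpow hρ.ne', div_self htρ.ne']
  have hgood : ∀ u ∈ badᶜ, t ≤ √(∑ k, ((2 * (N : ℝ) / ((u k : ℕ) + 1)) ^ ρ⁻¹ * z k) ^ 2) := by
    intro u hu
    simp only [hbad, Finset.mem_compl, Finset.mem_filter, Finset.mem_univ, true_and, not_forall,
      not_lt] at hu
    obtain ⟨k, hk⟩ := hu
    have h1 : t ≤ |(2 * (N : ℝ) / ((u k : ℕ) + 1)) ^ ρ⁻¹ * z k| := by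
      rw [abs_mul, abs_of_nonneg (by positivity),
        ← Real.rpow_le_rpow_iff ht.le (by positivity) hρ,
        Real.mul_rpow (by positivity) (by positivity), ← Real.rpow_mul (by positivity),
        inv_mul_cancel₀ hρ.ne', Real.rpow_one, div_mul_eq_mul_div, le_div_iff₀ (by positivity)]
      rw [mul_div_assoc', le_div_iff₀ htρ] at hk
      linarith
    refine h1.trans (Real.abs_le_sqrt ?_)
    exact Finset.single_le_sum
      (f := fun k => ((2 * (N : ℝ) / ((u k : ℕ) + 1)) ^ ρ⁻¹ * z k) ^ 2)
      (fun _ _ => sq_nonneg _) (Finset.mem_univ k)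
  have h2 : (badᶜ.card : ℝ) * t
      ≤ ∑ u : Fin N → Fin (2 * N), √(∑ k, ((2 * (N : ℝ) / ((u k : ℕ) + 1)) ^ ρ⁻¹ * z k) ^ 2) := by
    rw [← nsmul_eq_mul]
    refine (Finset.card_nsmul_le_sum _ _ _ hgood).trans ?_
    exact Finset.sum_le_sum_of_subset_of_nonneg (Finset.subset_univ _)
      fun _ _ _ => Real.sqrt_nonneg _
  have h3 : (bad.card : ℝ) + badᶜ.card = (2 * (N : ℝ)) ^ N := by
    have := Finset.card_add_card_compl bad
    rw [Fintype.card_pi] at this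
    simp only [Fintype.card_fin, Finset.prod_const, Finset.card_univ] at this
    exact_mod_cast this
  nlinarith

/-- A diagonal `ℓ_2`-valued bound in terms of the `ℓ_ρ` norm of the diagonal improves to an
`ℓ_ρ`-valued one, up to a logarithmic factor. -/
lemma sum_realLpNorm_mul_le_of_sum_sqrt_le {ι : Type*} [Fintype ι] {N : ℕ} (hN : 1 ≤ N) {ρ : ℝ}
    (hρ : 1 ≤ ρ) (a : ι → Fin N → ℝ) {B : ℝ} (hB : 0 ≤ B)
    (h : ∀ c : Fin N → ℝ, ∑ i, √(∑ k, (c k * a i k) ^ 2) ≤ B * realLpNorm ρ c) (c : Fin N → ℝ) :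
    ∑ i, realLpNorm ρ (fun k => c k * a i k)
      ≤ 3 * B * (∑ v : Fin (2 * N), ((v : ℕ) + 1 : ℝ)⁻¹) ^ ρ⁻¹ * realLpNorm ρ c := by
  have hρ0 : 0 < ρ := by linarith
  have hNr : (1 : ℝ) ≤ N := by exact_mod_cast hN
  set M : ℝ := 2 * (N : ℝ) with hM
  have hM0 : 0 < M := by positivity
  have hMN : 0 < M ^ N := by positivity
  set H : ℝ := ∑ v : Fin (2 * N), ((v : ℕ) + 1 : ℝ)⁻¹ with hH
  have hH0 : 0 ≤ H := by positivity
  set g : Fin (2 * N) → ℝ := fun v => (M / ((v : ℕ) + 1)) ^ ρ⁻¹ with hg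
  have hgρ : ∀ v, |g v| ^ ρ = M * ((v : ℕ) + 1 : ℝ)⁻¹ := fun v => by
    rw [hg, abs_of_nonneg (by positivity), ← Real.rpow_mul (by positivity),
      inv_mul_cancel₀ hρ0.ne', Real.rpow_one, div_eq_mul_inv]
  have h1 : M ^ N * ∑ i, realLpNorm ρ (fun k => c k * a i k)
      ≤ 3 * (B * ∑ u : Fin N → Fin (2 * N), realLpNorm ρ (fun k => g (u k) * c k)) := by
    rw [Finset.mul_sum]
    refine (Finset.sum_le_sum fun i _ => pow_mul_realLpNorm_le_sum_sqrt hN hρ0 _).trans ?_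
    rw [← Finset.mul_sum, Finset.sum_comm, Finset.mul_sum Finset.univ _ B]
    refine mul_le_mul_of_nonneg_left (Finset.sum_le_sum fun u _ => ?_) (by norm_num : (0 : ℝ) ≤ 3)
    refine le_trans (le_of_eq ?_) (h (fun k => g (u k) * c k))
    simp only [hg, mul_assoc]
    rfl
  -- The `ρ`-th moment of `g` is exactly the harmonic sum `H`; the truncation keeps it finite and is
  -- the source of the logarithm.
  have h2 : ∑ u : Fin N → Fin (2 * N), realLpNorm ρ (fun k => g (u k) * c k) ^ ρ
      = M ^ N * (H * realLpNorm ρ c ^ ρ) := by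
    simp_rw [realLpNorm_rpow hρ0.ne', abs_mul, Real.mul_rpow (abs_nonneg _) (abs_nonneg _), hgρ]
    rw [Finset.sum_comm, Finset.mul_sum, Finset.mul_sum]
    refine Finset.sum_congr rfl fun k _ => ?_
    rw [← Finset.sum_mul, ← Finset.mul_sum]
    have h3 := Fintype.sum_piFinset_apply (ι := Fin N)
      (fun v : Fin (2 * N) => ((v : ℕ) + 1 : ℝ)⁻¹) Finset.univ k
    rw [Fintype.piFinset_univ] at h3
    rw [h3, ← hH, nsmul_eq_mul]
    simp only [Finset.card_univ, Fintype.card_fin, Nat.cast_pow, Nat.cast_mul, Nat.cast_ofNat]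
    obtain ⟨n, rfl⟩ : ∃ n, N = n + 1 := ⟨N - 1, by omega⟩
    rw [← hM, Nat.add_sub_cancel, pow_succ]
    ring
  have h4 := Real.inner_le_weight_mul_Lp_of_nonneg Finset.univ hρ
    (fun _ : Fin N → Fin (2 * N) => (M ^ N)⁻¹)
    (fun u => realLpNorm ρ (fun k => g (u k) * c k)) (fun _ => by positivity)
    (fun _ => realLpNorm_nonneg _ _)
  rw [← Finset.mul_sum, ← Finset.mul_sum, h2] at h4
  have h5 : ∑ _u : Fin N → Fin (2 * N), (M ^ N)⁻¹ = 1 := by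
    simp only [Finset.sum_const, Finset.card_univ, Fintype.card_pi, Fintype.card_fin,
      Finset.prod_const, nsmul_eq_mul, Nat.cast_pow, Nat.cast_mul, Nat.cast_ofNat]
    exact mul_inv_cancel₀ hMN.ne'
  rw [h5, Real.one_rpow, one_mul, inv_mul_cancel_left₀ hMN.ne',
    Real.mul_rpow hH0 (Real.rpow_nonneg (realLpNorm_nonneg ρ c) ρ),
    ← Real.rpow_mul (realLpNorm_nonneg ρ c), mul_inv_cancel₀ hρ0.ne', Real.rpow_one,
    inv_mul_le_iff₀ hMN] at h4
  refine le_of_mul_le_mul_left (h1.trans ?_) hMN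
  have h6 := mul_le_mul_of_nonneg_left h4 (by positivity : 0 ≤ 3 * B)
  linarith

/-! ### Products of dominating vectors -/

/-- Dominating vectors in each variable give one for the coordinatewise product. -/
lemma sum_realLpNorm_mul_prod_le {m N : ℕ} {q : ℝ} {J : Fin m → ℕ}
    (a : ∀ i, Fin (J i) → Fin N → ℝ) (f : Fin m → Fin N → ℝ)
    (h : ∀ i, ∀ c : Fin N → ℝ,
      ∑ j, realLpNorm q (fun k => c k * a i j k) ≤ realLpNorm q (fun k => c k * f i k))
    (c : Fin N → ℝ) :
    ∑ j : (∀ i, Fin (J i)), realLpNorm q (fun k => c k * ∏ i, a i (j i) k)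
      ≤ realLpNorm q (fun k => c k * ∏ i, f i k) := by
  induction m generalizing c with
  | zero => simp
  | succ m ih =>
    rw [← (Fin.consEquiv (fun i => Fin (J i))).sum_comp, Fintype.sum_prod_type]
    have h1 : ∀ j₀ : Fin (J 0), ∑ j : (∀ i : Fin m, Fin (J i.succ)),
        realLpNorm q (fun k => c k * ∏ i, a i (Fin.consEquiv (fun i => Fin (J i)) (j₀, j) i) k)
          ≤ realLpNorm q (fun k => (c k * ∏ i : Fin m, f i.succ k) * a 0 j₀ k) := by
      intro j₀
      -- The factor `a 0 j₀` is absorbed into the multiplier, which is why the hypothesis is needed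
      -- for all `c`.
      have := ih (fun i => a i.succ) (fun i => f i.succ) (fun i => h i.succ)
        (fun k => c k * a 0 j₀ k)
      refine le_trans (le_of_eq ?_) (this.trans (le_of_eq ?_))
      · refine Finset.sum_congr rfl fun j _ => ?_
        congr 1
        ext k
        rw [Fin.prod_univ_succ, mul_assoc]
        rfl
      · congr 1
        ext k
        ring
    refine (Finset.sum_le_sum fun j₀ _ => h1 j₀).trans ((h 0 _).trans (le_of_eq ?_))
    congr 1
    ext k
    rw [Fin.prod_univ_succ]
    ring

/-- Hölder's inequality for `m` factors in the same `ℓ_p`, followed by the inclusion into `ℓ_q`. -/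
lemma realLpNorm_prod_le {m N : ℕ} (hm : 1 ≤ m) (hN : 1 ≤ N) {q δ : ℝ} (hq : 0 < q) (hδ : 0 < δ)
    (f : Fin m → Fin N → ℝ) (B : Fin m → ℝ) (hB : ∀ i, 0 < B i)
    (h : ∀ i, realLpNorm δ⁻¹ (f i) ≤ B i) :
    realLpNorm q (fun k => ∏ i, f i k) ≤ (N : ℝ) ^ max 0 (q⁻¹ - m * δ) * ∏ i, B i := by
  have hNr : (1 : ℝ) ≤ N := by exact_mod_cast hN
  have hmr : (0 : ℝ) < m := by exact_mod_cast hm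
  have hBp : 0 < ∏ i, B i := Finset.prod_pos fun i _ => hB i
  set p : ℝ := ((m : ℝ) * δ)⁻¹ with hp
  have hp0 : 0 < p := by positivity
  have hpinv : p⁻¹ = m * δ := by rw [hp, inv_inv]
  have hmain : realLpNorm p (fun k => ∏ i, f i k) ≤ ∏ i, B i := by
    rw [← Real.rpow_le_rpow_iff (realLpNorm_nonneg _ _) hBp.le hp0, realLpNorm_rpow hp0.ne']
    have h1 : ∀ k, |∏ i, f i k| ^ p
        ≤ (∏ i, B i) ^ p * ∑ i, (m : ℝ)⁻¹ * (|f i k| ^ δ⁻¹ / B i ^ δ⁻¹) := by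
      intro k
      -- Hölder with `m` equal exponents, via the arithmetic-geometric mean inequality for the
      -- factors normalized by `B i`.
      have h2 := Real.geom_mean_le_arith_mean_weighted Finset.univ (fun _ : Fin m => (m : ℝ)⁻¹)
        (fun i => |f i k| ^ δ⁻¹ / B i ^ δ⁻¹) (fun _ _ => by positivity)
        (by simp [hmr.ne']) (fun i _ => div_nonneg (by positivity)
          (Real.rpow_nonneg (hB i).le _))
      refine le_trans (le_of_eq ?_)
        (mul_le_mul_of_nonneg_left h2 (Real.rpow_nonneg hBp.le p))
      rw [Finset.abs_prod, ← Real.finsetProd_rpow _ _ (fun _ _ => abs_nonneg _),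
        ← Real.finsetProd_rpow _ _ (fun i _ => (hB i).le), ← Finset.prod_mul_distrib]
      refine Finset.prod_congr rfl fun i _ => ?_
      have hb := Real.rpow_pos_of_pos (hB i) p
      rw [Real.div_rpow (by positivity) (Real.rpow_nonneg (hB i).le _),
        ← Real.rpow_mul (abs_nonneg _), ← Real.rpow_mul (hB i).le,
        show δ⁻¹ * (m : ℝ)⁻¹ = p by rw [hp, mul_inv, mul_comm]]
      field_simp
    refine (Finset.sum_le_sum fun k _ => h1 k).trans ?_
    rw [← Finset.mul_sum]
    refine mul_le_of_le_one_right (Real.rpow_nonneg hBp.le p) ?_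
    rw [Finset.sum_comm]
    have h3 : ∀ i : Fin m, ∑ k, (m : ℝ)⁻¹ * (|f i k| ^ δ⁻¹ / B i ^ δ⁻¹) ≤ (m : ℝ)⁻¹ := by
      intro i
      rw [← Finset.mul_sum, ← Finset.sum_div, ← realLpNorm_rpow (inv_pos.2 hδ).ne']
      refine mul_le_of_le_one_right (by positivity) ?_
      rw [div_le_one (Real.rpow_pos_of_pos (hB i) _)]
      exact Real.rpow_le_rpow (realLpNorm_nonneg _ _) (h i) (by positivity)
    refine (Finset.sum_le_sum fun i _ => h3 i).trans ?_
    simp [hmr.ne']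
  rcases le_total p q with hpq | hpq
  · refine (realLpNorm_anti hp0 hpq _).trans (hmain.trans ?_)
    exact le_mul_of_one_le_left hBp.le (Real.one_le_rpow hNr (le_max_left _ _))
  · refine (realLpNorm_le_card_rpow_mul hq hpq _).trans ?_
    rw [Fintype.card_fin, hpinv]
    exact mul_le_mul (Real.rpow_le_rpow_of_exponent_le hNr (le_max_right _ _)) hmain
      (realLpNorm_nonneg _ _) (by positivity)

/-! ### Weak norms and functionals on `ℓ_r^N` -/

section weak

variable {𝕜 : Type*} [RCLike 𝕜] {E : Type*} [NormedAddCommGroup E] [NormedSpace 𝕜 E]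

lemma weakSeqNorm_one_ne_top {J : ℕ} (y : Fin J → E) : weakSeqNorm 𝕜 1 y ≠ ∞ := by
  refine ne_top_of_le_ne_top (b := ∑ j, ‖y j‖ₑ) (by simp [ENNReal.sum_eq_top]) ?_
  refine iSup₂_le fun γ hγ => ?_
  simp only [ENNReal.rpow_one, div_one]
  refine Finset.sum_le_sum fun j _ => ?_
  rw [← ofReal_norm, ← ofReal_norm]
  exact ENNReal.ofReal_le_ofReal ((γ.le_of_opNorm_le hγ _).trans_eq (one_mul _))

lemma sum_norm_apply_le_of_norm_le_one {J : ℕ} (y : Fin J → E) (γ : E →L[𝕜] 𝕜) (hγ : ‖γ‖ ≤ 1) :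
    ∑ j, ‖γ (y j)‖ ≤ (weakSeqNorm 𝕜 1 y).toReal := by
  have h : ∑ j, ‖γ (y j)‖ₑ ≤ weakSeqNorm 𝕜 1 y := by
    refine le_trans (le_of_eq ?_) (le_iSup₂_of_le γ hγ le_rfl)
    simp
  have h2 := ENNReal.toReal_mono (weakSeqNorm_one_ne_top y) h
  rw [ENNReal.toReal_sum (fun _ _ => enorm_ne_top)] at h2
  simpa using h2

lemma sum_norm_apply_le {J : ℕ} (y : Fin J → E) (γ : E →L[𝕜] 𝕜) {Λ : ℝ}
    (hγ : ‖γ‖ ≤ Λ) : ∑ j, ‖γ (y j)‖ ≤ Λ * (weakSeqNorm 𝕜 1 y).toReal := by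
  refine le_trans ?_ (mul_le_mul_of_nonneg_right hγ ENNReal.toReal_nonneg)
  rcases (norm_nonneg γ).eq_or_lt with h0 | h0
  · rw [norm_eq_zero.1 h0.symm]
    simp
  · have h1 := sum_norm_apply_le_of_norm_le_one y (((‖γ‖⁻¹ : ℝ) : 𝕜) • γ) (by
      rw [norm_smul, RCLike.norm_ofReal, abs_of_pos (inv_pos.2 h0), inv_mul_cancel₀ h0.ne'])
    simp only [smul_apply, norm_smul, RCLike.norm_ofReal,
      abs_of_pos (inv_pos.2 h0)] at h1
    rw [← Finset.mul_sum, inv_mul_le_iff₀ h0] at h1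
    exact h1

end weak

section sequenceSpace

variable {𝕜 : Type*} [RCLike 𝕜] {N : ℕ} {r : ℝ≥0∞} [Fact (1 ≤ r)]

lemma norm_eq_realLpNorm (hr : r ≠ ∞) (v : PiLp r (fun _ : Fin N => 𝕜)) :
    ‖v‖ = realLpNorm r.toReal (fun k => ‖v k‖) := by
  have h1 : (1 : ℝ≥0∞) ≤ r := Fact.out
  have hr0 : 0 < r.toReal := ENNReal.toReal_pos (zero_lt_one.trans_le h1).ne' hr
  rw [PiLp.norm_eq_sum hr0, realLpNorm]
  simp [abs_of_nonneg]

/-- The functional `v ↦ ∑ k, c k * v k` on `ℓ_r^N`. -/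
noncomputable def coordFunctional (r : ℝ≥0∞) [Fact (1 ≤ r)] (c : Fin N → 𝕜) :
    PiLp r (fun _ : Fin N => 𝕜) →L[𝕜] 𝕜 :=
  ∑ k, c k • (PiLp.proj r (fun _ : Fin N => 𝕜) k : PiLp r (fun _ : Fin N => 𝕜) →L[𝕜] 𝕜)

lemma coordFunctional_apply (c : Fin N → 𝕜) (v : PiLp r (fun _ : Fin N => 𝕜)) :
    coordFunctional r c v = ∑ k, c k * v k := by
  simp [coordFunctional]

lemma norm_coordFunctional_le_realLpNorm {r' : ℝ≥0∞} (hr : ENNReal.HolderConjugate r r')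
    (hr1 : r ≠ 1) (c : Fin N → 𝕜) :
    ‖coordFunctional r c‖ ≤ realLpNorm r'.toReal (fun k => ‖c k‖) := by
  refine ContinuousLinearMap.opNorm_le_bound _ (realLpNorm_nonneg _ _) fun v => ?_
  rw [coordFunctional_apply]
  refine (norm_sum_le _ _).trans ?_
  simp_rw [norm_mul]
  have hinv := ENNReal.HolderConjugate.inv_add_inv_eq_one r r'
  have h1 : (1 : ℝ≥0∞) ≤ r := Fact.out
  by_cases hrt : r = ∞
  · subst hrt
    have hr' : r' = 1 := by simpa using hinv
    subst hr'
    simp only [realLpNorm, ENNReal.toReal_one, Real.rpow_one, inv_one, abs_norm]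
    rw [Finset.sum_mul]
    exact Finset.sum_le_sum fun k _ =>
      mul_le_mul_of_nonneg_left (PiLp.norm_apply_le v k) (norm_nonneg _)
  · have h1' : 1 < r := lt_of_le_of_ne h1 (Ne.symm hr1)
    have hr'0 : r' ≠ 0 := by
      rintro rfl
      simp at hinv
    have hr't : r' ≠ ∞ := by
      rintro rfl
      simp at hinv
      exact hr1 hinv
    have hconj : r'.toReal.HolderConjugate r.toReal := by
      have h1r : 1 < r.toReal := by
        rw [← ENNReal.toReal_one]
        exact (ENNReal.toReal_lt_toReal ENNReal.one_ne_top hrt).2 h1'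
      refine Real.HolderConjugate.symm ((Real.holderConjugate_iff).2 ⟨h1r, ?_⟩)
      have := congrArg ENNReal.toReal hinv
      rwa [ENNReal.toReal_add (by simp; exact (zero_lt_one.trans h1').ne') (by simpa using hr'0),
        ENNReal.toReal_inv, ENNReal.toReal_inv, ENNReal.toReal_one] at this
    rw [norm_eq_realLpNorm hrt]
    have := Real.inner_le_Lp_mul_Lq Finset.univ (fun k => ‖c k‖) (fun k => ‖v k‖) hconj
    simpa [realLpNorm] using this

lemma norm_coordFunctional_one_le (c : Fin N → 𝕜) {Λ : ℝ} (hΛ : 0 ≤ Λ) (hc : ∀ k, ‖c k‖ ≤ Λ) :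
    ‖coordFunctional 1 c‖ ≤ Λ := by
  refine ContinuousLinearMap.opNorm_le_bound _ hΛ fun v => ?_
  rw [coordFunctional_apply, PiLp.norm_eq_of_L1, Finset.mul_sum]
  refine norm_sum_le_of_le _ fun k _ => ?_
  rw [norm_mul]
  exact mul_le_mul_of_nonneg_right (hc k) (norm_nonneg _)

/-- Khinchin's inequality bounds an `ℓ_2`-valued diagonal operator by the weak norm. -/
lemma sum_sqrt_le_weakSeqNorm {J : ℕ} (x : Fin J → PiLp r (fun _ : Fin N => 𝕜)) (c : Fin N → ℝ)
    {Λ : ℝ} (h : ∀ c' : Fin N → 𝕜, (∀ k, ‖c' k‖ = |c k|) → ‖coordFunctional r c'‖ ≤ Λ) :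
    ∑ j, √(∑ k, (c k * ‖x j k‖) ^ 2) ≤ 9 / 5 * (Λ * (weakSeqNorm 𝕜 1 x).toReal) := by
  have h2N : (0 : ℝ) < 2 ^ N := by positivity
  refine le_of_mul_le_mul_left ?_ h2N
  rw [Finset.mul_sum]
  have h1 : ∀ j, 2 ^ N * √(∑ k, (c k * ‖x j k‖) ^ 2)
      ≤ 9 / 5 * ∑ e : Fin N → Bool,
        ‖coordFunctional r (fun k => (boolSign (e k) : 𝕜) * (c k : 𝕜)) (x j)‖ := by
    intro j
    have := sqrt_sum_sq_le_sum_norm_signed_sum (fun k => (c k : 𝕜) * x j k)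
    simp only [norm_mul, RCLike.norm_ofReal, mul_pow, sq_abs] at this
    simp only [mul_pow, coordFunctional_apply, mul_assoc]
    exact this
  refine (Finset.sum_le_sum fun j _ => h1 j).trans ?_
  rw [← Finset.mul_sum, Finset.sum_comm]
  have h2 : ∀ e : Fin N → Bool,
      ∑ j, ‖coordFunctional r (fun k => (boolSign (e k) : 𝕜) * (c k : 𝕜)) (x j)‖
        ≤ Λ * (weakSeqNorm 𝕜 1 x).toReal := fun e =>
    sum_norm_apply_le x _ (h _ fun k => by
      rw [norm_mul, RCLike.norm_ofReal, RCLike.norm_ofReal, abs_boolSign, one_mul])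
  have h3 := Finset.sum_le_sum fun (e : Fin N → Bool) (_ : e ∈ Finset.univ) => h2 e
  simp only [Finset.sum_const, Finset.card_univ, Fintype.card_pi, Fintype.card_bool,
    Finset.prod_const, Fintype.card_fin, nsmul_eq_mul, Nat.cast_pow, Nat.cast_ofNat] at h3
  linarith

lemma eq_zero_of_weakSeqNorm_toReal_eq_zero {J : ℕ} (x : Fin J → PiLp r (fun _ : Fin N => 𝕜))
    (h : (weakSeqNorm 𝕜 1 x).toReal = 0) (j : Fin J) (k : Fin N) : x j k = 0 := by
  have h1 := sum_norm_apply_le x (coordFunctional r (Pi.single k (1 : 𝕜))) le_rfl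
  rw [h, mul_zero] at h1
  have h2 := Finset.single_le_sum (f := fun j => ‖coordFunctional r (Pi.single k (1 : 𝕜)) (x j)‖)
    (fun _ _ => norm_nonneg _) (Finset.mem_univ j)
  have h3 := norm_le_zero_iff.1 (h2.trans h1)
  simpa [coordFunctional_apply, Pi.single_apply] using h3

end sequenceSpace

/-! ### Dominating vectors by duality -/

/-- Dominating vector in `ℓ_{1/δ}`, `δ = 1/2 - 1/ρ`, from a diagonal bound in `ℓ_ρ`, `ρ > 2`. -/
lemma exists_dominating_of_sum_sqrt_le {ι κ : Type*} [Fintype ι] [Fintype κ] (a : ι → κ → ℝ)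
    {ρ δ : ℝ} (hρ : 2 < ρ) (hδ : δ = 1 / 2 - ρ⁻¹) {M M' : ℝ} (hMM : M < M')
    (h : ∀ c : κ → ℝ, realLpNorm ρ c ≤ 1 → ∑ i, √(∑ k, (c k * a i k) ^ 2) ≤ M) :
    ∃ f : κ → ℝ, realLpNorm δ⁻¹ f ≤ M' ∧ ∀ q : ℝ, 1 ≤ q → q ≤ 2 → ∀ c : κ → ℝ,
      ∑ i, realLpNorm q (fun k => c k * a i k) ≤ realLpNorm q (fun k => c k * f k) := by
  have hρ0 : 0 < ρ := by linarith
  set p : ℝ := ρ / 2 with hp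
  have hp1 : 1 < p := by rw [hp]; linarith
  have hp0 : 0 < p := by linarith
  have hδ0 : 0 < δ := by
    rw [hδ, sub_pos, inv_eq_one_div]
    exact one_div_lt_one_div_of_lt two_pos hρ
  set p' : ℝ := (2 * δ)⁻¹ with hp'
  have hp'0 : 0 < p' := by positivity
  have hconj : p'.HolderConjugate p := by
    refine Real.HolderConjugate.symm (Real.holderConjugate_iff.2 ⟨hp1, ?_⟩)
    rw [hp', inv_inv, hδ, hp]
    field_simp
    ring
  -- The densities are the squares `d = c²` of multipliers in the unit ball of `ℓ_ρ`, that is, the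
  -- positive part of the unit ball of `ℓ_{ρ/2}`.
  set D : Set (κ → ℝ) := {d | (∀ k, 0 ≤ d k) ∧ ∑ k, d k ^ p ≤ 1} with hD
  have hclosed : IsClosed D := by
    have h1 : D = (⋂ k, {d : κ → ℝ | 0 ≤ d k}) ∩ {d | ∑ k, d k ^ p ≤ 1} := by
      ext d
      simp [hD]
    rw [h1]
    refine (isClosed_iInter fun k => isClosed_le continuous_const (continuous_apply k)).inter
      (isClosed_le ?_ continuous_const)
    exact continuous_finsetSum _ fun k _ =>
      (continuous_apply k).rpow_const fun _ => Or.inr hp0.le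
  have hcompact : IsCompact D := by
    refine (isCompact_Icc (a := (0 : κ → ℝ)) (b := 1)).of_isClosed_subset hclosed ?_
    rintro d ⟨hd0, hd1⟩
    refine ⟨fun k => hd0 k, fun k => ?_⟩
    have h1 := (Finset.single_le_sum (f := fun k => d k ^ p)
      (fun k _ => Real.rpow_nonneg (hd0 k) p) (Finset.mem_univ k)).trans hd1
    by_contra! h2
    exact absurd h1 (not_le.2 (Real.one_lt_rpow h2 hp0))
  have hconv : Convex ℝ D := by
    rintro d ⟨hd0, hd1⟩ e ⟨he0, he1⟩ s t hs ht hst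
    refine ⟨fun k => ?_, ?_⟩
    · exact add_nonneg (mul_nonneg hs (hd0 k)) (mul_nonneg ht (he0 k))
    · have h1 : ∀ k, (s • d + t • e) k ^ p ≤ s * d k ^ p + t * e k ^ p := fun k =>
        (convexOn_rpow hp1.le).2 (hd0 k) (he0 k) hs ht hst
      refine (Finset.sum_le_sum fun k _ => h1 k).trans ?_
      rw [Finset.sum_add_distrib, ← Finset.mul_sum, ← Finset.mul_sum]
      nlinarith
  have hne : D.Nonempty := ⟨0, fun _ => le_rfl, by simp [Real.zero_rpow hp0.ne']⟩
  obtain ⟨w, hw, hw1, hwD⟩ := exists_weights_of_sum_sqrt_le a hcompact hconv hne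
    (fun d hd => hd.1) hMM (by
      rintro d ⟨hd0, hd1⟩
      have h1 := h (fun k => √(d k)) (by
        unfold realLpNorm
        refine Real.rpow_le_one (by positivity) (le_trans (le_of_eq ?_) hd1) (by positivity)
        refine Finset.sum_congr rfl fun k _ => ?_
        rw [abs_of_nonneg (Real.sqrt_nonneg _), Real.sqrt_eq_rpow, ← Real.rpow_mul (hd0 k)]
        congr 1
        rw [hp]
        ring)
      simpa only [mul_pow, Real.sq_sqrt (hd0 _)] using h1)
  have hM' : 0 ≤ M' := by
    have h1 := h 0 (by
      unfold realLpNorm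
      simp [Real.zero_rpow hρ0.ne', Real.zero_rpow (inv_pos.2 hρ0).ne'])
    simp at h1
    linarith
  refine ⟨fun k => √(∑ i, a i k ^ 2 / w i), ?_, fun q hq1 hq2 c =>
    sum_realLpNorm_mul_le_of_weights a w hw hw1 hq1 hq2 c⟩
  have hv0 : ∀ k, 0 ≤ ∑ i, a i k ^ 2 / w i := fun k =>
    Finset.sum_nonneg fun i _ => div_nonneg (sq_nonneg _) (hw i).le
  set v : κ → ℝ≥0 := fun k => ⟨∑ i, a i k ^ 2 / w i, hv0 k⟩ with hv
  -- A norming element `g` of `D` for `v = f²`: the weighted bound at `g` says that the `ℓ_{p'}`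
  -- norm of `f²` is at most `M'²`, and `2 p' = 1/δ`.
  obtain ⟨g, hg, hgv⟩ := (NNReal.isGreatest_Lp Finset.univ v hconj).1
  have hgD : (fun k => (g k : ℝ)) ∈ D := ⟨fun k => (g k).2, by
    have h1 : ∑ k, g k ^ p ≤ 1 := hg
    change ∑ k, (g k : ℝ) ^ p ≤ 1
    exact_mod_cast h1⟩
  have h2 : (∑ k, (v k : ℝ) ^ p') ^ (1 / p') ≤ M' ^ 2 := by
    have h3 := hwD _ hgD
    have h4 := congrArg ((↑) : ℝ≥0 → ℝ) hgv
    push_cast at h4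
    rw [← h4]
    refine le_trans (le_of_eq (Finset.sum_congr rfl fun k _ => ?_)) h3
    rw [mul_comm]
    rfl
  have h5 : realLpNorm δ⁻¹ (fun k => √(∑ i, a i k ^ 2 / w i))
      = ((∑ k, (v k : ℝ) ^ p') ^ (1 / p')) ^ (1 / 2 : ℝ) := by
    unfold realLpNorm
    rw [← Real.rpow_mul (by positivity)]
    have h6 : ∀ k, |√(∑ i, a i k ^ 2 / w i)| ^ δ⁻¹ = (v k : ℝ) ^ p' := fun k => by
      rw [abs_of_nonneg (Real.sqrt_nonneg _), Real.sqrt_eq_rpow, ← Real.rpow_mul (hv0 k)]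
      simp only [hv, hp']
      congr 1
      field_simp
    simp_rw [h6]
    congr 1
    rw [hp']
    field_simp
  rw [h5, ← Real.sqrt_eq_rpow]
  exact Real.sqrt_le_iff.2 ⟨hM', h2⟩

/-- The case `ρ = ∞` of `exists_dominating_of_sum_sqrt_le`. -/
lemma exists_dominating_of_sum_sqrt_le_of_abs_le {ι κ : Type*} [Fintype ι] [Fintype κ]
    (a : ι → κ → ℝ) {M M' : ℝ} (hMM : M < M')
    (h : ∀ c : κ → ℝ, (∀ k, |c k| ≤ 1) → ∑ i, √(∑ k, (c k * a i k) ^ 2) ≤ M) :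
    ∃ f : κ → ℝ, realLpNorm 2 f ≤ M' ∧ ∀ q : ℝ, 1 ≤ q → q ≤ 2 → ∀ c : κ → ℝ,
      ∑ i, realLpNorm q (fun k => c k * a i k) ≤ realLpNorm q (fun k => c k * f k) := by
  obtain ⟨w, hw, hw1, hwD⟩ := exists_weights_of_sum_sqrt_le a (D := Set.Icc 0 1) isCompact_Icc
    (convex_Icc _ _) ⟨0, le_rfl, zero_le_one⟩ (fun d hd k => hd.1 k) hMM (by
      rintro d ⟨hd0, hd1⟩
      have h1 := h (fun k => √(d k)) (fun k => by
        rw [abs_of_nonneg (Real.sqrt_nonneg _)]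
        exact Real.sqrt_le_one.2 (hd1 k))
      have h2 : ∀ k, √(d k) ^ 2 = d k := fun k => Real.sq_sqrt (hd0 k)
      simpa only [mul_pow, h2] using h1)
  have hM' : 0 ≤ M' := by
    have h1 := h 0 (by simp)
    simp at h1
    linarith
  refine ⟨fun k => √(∑ i, a i k ^ 2 / w i), ?_, fun q hq1 hq2 c =>
    sum_realLpNorm_mul_le_of_weights a w hw hw1 hq1 hq2 c⟩
  rw [realLpNorm_two]
  refine Real.sqrt_le_iff.2 ⟨hM', ?_⟩
  -- On the cube the extreme density is the constant one, which gives the `ℓ_1` norm of `f²`.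
  have h1 := hwD 1 ⟨zero_le_one, le_rfl⟩
  refine le_trans (le_of_eq (Finset.sum_congr rfl fun k _ => ?_)) h1
  rw [Real.sq_sqrt (Finset.sum_nonneg fun i _ => div_nonneg (sq_nonneg _) (hw i).le)]
  simp

/-! ### Upper bounds for the summing norm -/

section upper

variable {𝕜 : Type*} [RCLike 𝕜] {m N : ℕ} {r q : ℝ≥0∞} [Fact (1 ≤ r)] [Fact (1 ≤ q)]

lemma norm_diagonalMap (hq : q ≠ ∞) (x : Fin m → PiLp r (fun _ : Fin N => 𝕜)) :
    ‖diagonalMap 𝕜 m N r q x‖ = realLpNorm q.toReal (fun k => ∏ i, ‖x i k‖) := by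
  rw [norm_eq_realLpNorm hq]
  congr 1
  ext k
  change ‖∏ i, x i k‖ = _
  exact norm_prod _ _

lemma multipleSummingNorm_diagonalMap_le (hq : q ≠ ∞) {C : ℝ} (hC : 0 ≤ C)
    (h : ∀ (J : Fin m → ℕ) (x : ∀ i, Fin (J i) → PiLp r (fun _ : Fin N => 𝕜)),
      ∑ j : (∀ i, Fin (J i)), realLpNorm q.toReal (fun k => ∏ i, ‖x i (j i) k‖)
        ≤ C * ∏ i, (weakSeqNorm 𝕜 1 (x i)).toReal) :
    multipleSummingNorm 1 (diagonalMap 𝕜 m N r q) ≤ ENNReal.ofReal C := by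
  refine iInf₂_le_of_le C.toNNReal ?_ le_rfl
  intro J x
  simp only [ENNReal.rpow_one, div_one]
  have h1 : (∑ j : (∀ i, Fin (J i)), ‖diagonalMap 𝕜 m N r q (fun i => x i (j i))‖ₑ)
      = ENNReal.ofReal (∑ j : (∀ i, Fin (J i)),
        realLpNorm q.toReal (fun k => ∏ i, ‖x i (j i) k‖)) := by
    rw [ENNReal.ofReal_sum_of_nonneg (fun _ _ => realLpNorm_nonneg _ _)]
    refine Finset.sum_congr rfl fun j _ => ?_
    rw [← ofReal_norm, norm_diagonalMap hq]
  have h2 : ∏ i, weakSeqNorm 𝕜 1 (x i)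
      = ENNReal.ofReal (∏ i, (weakSeqNorm 𝕜 1 (x i)).toReal) := by
    rw [ENNReal.ofReal_prod_of_nonneg (fun _ _ => ENNReal.toReal_nonneg)]
    exact Finset.prod_congr rfl fun i _ =>
      (ENNReal.ofReal_toReal (weakSeqNorm_one_ne_top _)).symm
  rw [h1, h2]
  change _ ≤ ENNReal.ofReal C * _
  rw [← ENNReal.ofReal_mul hC]
  exact ENNReal.ofReal_le_ofReal (h J x)

/-- Upper bound for `r ≥ 2`, with `ρ` the conjugate exponent of `r`. -/
lemma multipleSummingNorm_diagonalMap_le_of_two_le {r' : ℝ≥0∞}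
    (hr : ENNReal.HolderConjugate r r') (hr1 : r ≠ 1) (hρ : 1 ≤ r'.toReal) (hq : q ≠ ∞)
    (hN : 1 ≤ N) :
    multipleSummingNorm 1 (diagonalMap 𝕜 m N r q) ≤ ENNReal.ofReal
      ((27 / 5 * (∑ v : Fin (2 * N), ((v : ℕ) + 1 : ℝ)⁻¹) ^ (r'.toReal)⁻¹) ^ m
        * (N : ℝ) ^ max (q.toReal)⁻¹ (r'.toReal)⁻¹) := by
  set ρ := r'.toReal with hρd
  have hρ0 : 0 < ρ := by linarith
  have hNr : (1 : ℝ) ≤ N := by exact_mod_cast hN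
  have hq0 : 0 < q.toReal := ENNReal.toReal_pos (zero_lt_one.trans_le Fact.out).ne' hq
  set H := ∑ v : Fin (2 * N), ((v : ℕ) + 1 : ℝ)⁻¹ with hH
  have hH0 : 0 ≤ H := by positivity
  refine multipleSummingNorm_diagonalMap_le hq (by positivity) fun J x => ?_
  set W : Fin m → ℝ := fun i => (weakSeqNorm 𝕜 1 (x i)).toReal with hW
  have hW0 : ∀ i, 0 ≤ W i := fun i => ENNReal.toReal_nonneg
  -- The dominating vector is constant; `27/5` is the product of `3` from the randomization and
  -- `9/5` from Khinchin.
  have hdom : ∀ i, ∀ c : Fin N → ℝ, ∑ j, realLpNorm ρ (fun k => c k * ‖x i j k‖)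
      ≤ realLpNorm ρ (fun k => c k * (27 / 5 * H ^ ρ⁻¹ * W i)) := by
    intro i c
    have h1 := sum_realLpNorm_mul_le_of_sum_sqrt_le hN hρ (fun j k => ‖x i j k‖)
      (B := 9 / 5 * W i) (by have := hW0 i; positivity) (fun c => by
        have h2 := sum_sqrt_le_weakSeqNorm (x i) c (Λ := realLpNorm ρ c) (fun c' hc' => by
          refine (norm_coordFunctional_le_realLpNorm hr hr1 c').trans ?_
          exact realLpNorm_mono hρ0 fun k => by rw [hc', abs_abs])
        refine h2.trans (le_of_eq ?_)
        simp only [hW]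
        ring) c
    refine h1.trans (le_of_eq ?_)
    simp_rw [mul_comm (c _)]
    rw [realLpNorm_const_mul hρ0, abs_of_nonneg (by have := hW0 i; positivity)]
    ring
  have h3 := sum_realLpNorm_mul_prod_le (fun i j k => ‖x i j k‖) _ hdom (fun _ => 1)
  simp only [one_mul] at h3
  have h4 : realLpNorm ρ (fun _ : Fin N => ∏ i, (27 / 5 * H ^ ρ⁻¹ * W i))
      = (27 / 5 * H ^ ρ⁻¹) ^ m * (∏ i, W i) * (N : ℝ) ^ ρ⁻¹ := by
    have hp : 0 ≤ ∏ i, (27 / 5 * H ^ ρ⁻¹ * W i) :=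
      Finset.prod_nonneg fun i _ => by have := hW0 i; positivity
    unfold realLpNorm
    rw [Finset.sum_const, Finset.card_univ, Fintype.card_fin, nsmul_eq_mul, abs_of_nonneg hp,
      Real.mul_rpow (by positivity) (by positivity), ← Real.rpow_mul hp,
      mul_inv_cancel₀ hρ0.ne', Real.rpow_one, Finset.prod_mul_distrib, Finset.prod_const,
      Finset.card_univ, Fintype.card_fin]
    ring
  rw [h4] at h3
  have hWp : 0 ≤ ∏ i, W i := Finset.prod_nonneg fun i _ => hW0 i
  rcases le_total ρ q.toReal with hle | hle
  · refine (Finset.sum_le_sum fun j _ => realLpNorm_anti hρ0 hle _).trans (h3.trans ?_)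
    rw [max_eq_right (inv_anti₀ hρ0 hle)]
    exact le_of_eq (by ring)
  · refine (Finset.sum_le_sum fun j _ => realLpNorm_le_card_rpow_mul hq0 hle _).trans ?_
    rw [← Finset.mul_sum, max_eq_left (inv_anti₀ hq0 hle), Fintype.card_fin]
    refine (mul_le_mul_of_nonneg_left h3 (by positivity)).trans (le_of_eq ?_)
    have h5 : (N : ℝ) ^ (q.toReal)⁻¹ = (N : ℝ) ^ ((q.toReal)⁻¹ - ρ⁻¹) * (N : ℝ) ^ ρ⁻¹ := by
      rw [← Real.rpow_add (by linarith), sub_add_cancel]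
    rw [h5]
    ring

/-- Each sequence in `ℓ_r^N`, `r < 2`, has a dominating vector. -/
lemma exists_dominating_of_lt_two {r' : ℝ≥0∞} (hr : ENNReal.HolderConjugate r r') (hr2 : r < 2)
    {J : ℕ} (x : Fin J → PiLp r (fun _ : Fin N => 𝕜)) (hW : 0 < (weakSeqNorm 𝕜 1 x).toReal) :
    ∃ f : Fin N → ℝ, realLpNorm (1 / r.toReal - 1 / 2)⁻¹ f ≤ 2 * (weakSeqNorm 𝕜 1 x).toReal ∧
      ∀ q : ℝ, 1 ≤ q → q ≤ 2 → ∀ c : Fin N → ℝ,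
      ∑ j, realLpNorm q (fun k => c k * ‖x j k‖) ≤ realLpNorm q (fun k => c k * f k) := by
  set W := (weakSeqNorm 𝕜 1 x).toReal with hWd
  -- The change of weights needs strict room above the Khinchin constant, hence the assumption `0 <
  -- W`.
  have hlt : 9 / 5 * W < 2 * W := by linarith
  have h1 : (1 : ℝ≥0∞) ≤ r := Fact.out
  have hinv := ENNReal.HolderConjugate.inv_add_inv_eq_one r r'
  by_cases hr1 : r = 1
  · subst hr1
    have he : (1 / (1 : ℝ≥0∞).toReal - 1 / 2 : ℝ)⁻¹ = 2 := by norm_num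
    rw [he]
    refine exists_dominating_of_sum_sqrt_le_of_abs_le (fun j k => ‖x j k‖) hlt fun c hc => ?_
    have := sum_sqrt_le_weakSeqNorm x c (Λ := 1) (fun c' hc' =>
      norm_coordFunctional_one_le c' zero_le_one fun k => by rw [hc']; exact hc k)
    rwa [one_mul] at this
  · have hrt : r ≠ ∞ := (hr2.trans (by simp)).ne
    have hr0 : 0 < r.toReal := ENNReal.toReal_pos (zero_lt_one.trans_le h1).ne' hrt
    have hr2' : r.toReal < 2 := by
      simpa using (ENNReal.toReal_lt_toReal hrt (by simp)).2 hr2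
    have hr1' : 1 < r.toReal := by
      simpa using (ENNReal.toReal_lt_toReal (by simp) hrt).2 (lt_of_le_of_ne h1 (Ne.symm hr1))
    have hr'0 : r' ≠ 0 := by
      rintro rfl
      simp at hinv
    have hreal : (r.toReal)⁻¹ + (r'.toReal)⁻¹ = 1 := by
      have := congrArg ENNReal.toReal hinv
      rwa [ENNReal.toReal_add (by simpa using (zero_lt_one.trans_le h1).ne') (by simpa using hr'0),
        ENNReal.toReal_inv, ENNReal.toReal_inv, ENNReal.toReal_one] at this
    have hinv2 : (2 : ℝ)⁻¹ < (r.toReal)⁻¹ := inv_strictAnti₀ hr0 hr2'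
    have hinv1 : (r.toReal)⁻¹ < 1 := inv_lt_one_of_one_lt₀ hr1'
    have hr'pos : 0 < (r'.toReal)⁻¹ := by linarith
    have hr'2 : 2 < r'.toReal := by
      rw [← inv_lt_inv₀ (inv_pos.1 hr'pos) two_pos]
      linarith
    refine exists_dominating_of_sum_sqrt_le (fun j k => ‖x j k‖) hr'2 (by
      rw [one_div]
      linarith) hlt fun c hc => ?_
    have := sum_sqrt_le_weakSeqNorm x c (Λ := 1) (fun c' hc' => by
      refine (norm_coordFunctional_le_realLpNorm hr hr1 c').trans (le_trans ?_ hc)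
      exact realLpNorm_mono (by linarith) fun k => by rw [hc', abs_abs])
    rwa [one_mul] at this

/-- Upper bound for `1 ≤ r < 2`. -/
lemma multipleSummingNorm_diagonalMap_le_of_lt_two {r' : ℝ≥0∞} (hm : 1 ≤ m)
    (hr : ENNReal.HolderConjugate r r') (hr2 : r < 2) (hq2 : q ≤ 2) (hN : 1 ≤ N) :
    multipleSummingNorm 1 (diagonalMap 𝕜 m N r q) ≤ ENNReal.ofReal
      (2 ^ m * (N : ℝ) ^ max 0 ((q.toReal)⁻¹ - m * (1 / r.toReal - 1 / 2))) := by
  have hqt : q ≠ ∞ := ne_top_of_le_ne_top (by simp) hq2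
  have hq1 : 1 ≤ q.toReal := by
    simpa using ENNReal.toReal_mono hqt (Fact.out : (1 : ℝ≥0∞) ≤ q)
  have hq2' : q.toReal ≤ 2 := by simpa using ENNReal.toReal_mono (by simp) hq2
  have h1 : (1 : ℝ≥0∞) ≤ r := Fact.out
  have hrt : r ≠ ∞ := (hr2.trans (by simp)).ne
  have hr0 : 0 < r.toReal := ENNReal.toReal_pos (zero_lt_one.trans_le h1).ne' hrt
  have hδ : 0 < 1 / r.toReal - 1 / 2 := by
    rw [sub_pos]
    exact one_div_lt_one_div_of_lt hr0
      (by simpa using (ENNReal.toReal_lt_toReal hrt (by simp)).2 hr2)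
  refine multipleSummingNorm_diagonalMap_le hqt (by positivity) fun J x => ?_
  by_cases hW : ∀ i, 0 < (weakSeqNorm 𝕜 1 (x i)).toReal
  · choose f hf hdom using fun i => exists_dominating_of_lt_two hr hr2 (x i) (hW i)
    have h3 := sum_realLpNorm_mul_prod_le (fun i j k => ‖x i j k‖) f
      (fun i c => hdom i q.toReal hq1 hq2' c) (fun _ => 1)
    simp only [one_mul] at h3
    refine h3.trans ((realLpNorm_prod_le hm hN (by linarith) hδ f _
      (fun i => by have := hW i; positivity) hf).trans (le_of_eq ?_))
    rw [Finset.prod_mul_distrib, Finset.prod_const, Finset.card_univ, Fintype.card_fin]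
    ring
  · push Not at hW
    obtain ⟨i, hi⟩ := hW
    have h0 := eq_zero_of_weakSeqNorm_toReal_eq_zero (x i) (le_antisymm hi ENNReal.toReal_nonneg)
    have h2 : ∀ j : (∀ i, Fin (J i)),
        realLpNorm q.toReal (fun k => ∏ i, ‖x i (j i) k‖) = 0 := fun j => by
      have h4 : ∀ k, ∏ i, ‖x i (j i) k‖ = 0 := fun k =>
        Finset.prod_eq_zero (Finset.mem_univ i) (by rw [h0, norm_zero])
      simp_rw [h4]
      have hq0 : q.toReal ≠ 0 := by linarith
      simp [realLpNorm, Real.zero_rpow hq0, Real.zero_rpow (inv_ne_zero hq0)]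
    simp_rw [h2, Finset.sum_const_zero]
    exact mul_nonneg (by positivity) (Finset.prod_nonneg fun _ _ => ENNReal.toReal_nonneg)

end upper

/-! ### Test families and lower bounds -/

section signVector

variable {𝕜 : Type*} [RCLike 𝕜] {N : ℕ} {r : ℝ≥0∞}

/-- The sign vectors in `ℓ_r^N`. -/
noncomputable def signVector (𝕜 : Type*) [RCLike 𝕜] (r : ℝ≥0∞) {N : ℕ} (e : Fin N → Bool) :
    PiLp r (fun _ : Fin N => 𝕜) := WithLp.toLp r (fun k => (boolSign (e k) : 𝕜))

lemma norm_signVector_apply (e : Fin N → Bool) (k : Fin N) : ‖signVector 𝕜 r e k‖ = 1 := by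
  simp [signVector, abs_boolSign]

lemma apply_toLp_eq_sum (γ : PiLp r (fun _ : Fin N => 𝕜) →L[𝕜] 𝕜) (v : Fin N → 𝕜) :
    γ (WithLp.toLp r v) = ∑ k, v k * γ (WithLp.toLp r (Pi.single k 1)) := by
  have h : (WithLp.toLp r v : PiLp r (fun _ : Fin N => 𝕜)) = ∑ k, v k •
      (WithLp.toLp r (Pi.single k (1 : 𝕜)) : PiLp r (fun _ : Fin N => 𝕜)) := by
    ext l
    simp [Pi.single_apply]
  rw [h, map_sum]
  simp

end signVector

section lower

variable {𝕜 : Type*} [RCLike 𝕜] {m N : ℕ} {r q : ℝ≥0∞} [Fact (1 ≤ r)] [Fact (1 ≤ q)]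

/-- The exponent of `N` in the norm of the inclusion `ℓ_2^N → ℓ_r^N`. -/
noncomputable def inclusionExponent (r : ℝ≥0∞) : ℝ := max 0 (1 / r.toReal - 1 / 2)

lemma norm_toLp_le (hN : 1 ≤ N) (v : Fin N → 𝕜) :
    ‖(WithLp.toLp r v : PiLp r (fun _ : Fin N => 𝕜))‖
      ≤ (N : ℝ) ^ inclusionExponent r * realLpNorm 2 (fun k => ‖v k‖) := by
  have hNr : (1 : ℝ) ≤ N := by exact_mod_cast hN
  have hone : 1 ≤ (N : ℝ) ^ inclusionExponent r := Real.one_le_rpow hNr (le_max_left _ _)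
  have hmain : realLpNorm 2 (fun k => ‖v k‖)
      ≤ (N : ℝ) ^ inclusionExponent r * realLpNorm 2 (fun k => ‖v k‖) :=
    le_mul_of_one_le_left (realLpNorm_nonneg _ _) hone
  by_cases hrt : r = ∞
  · subst hrt
    refine le_trans ?_ hmain
    rw [PiLp.norm_toLp, pi_norm_le_iff_of_nonneg (realLpNorm_nonneg _ _)]
    intro k
    have := abs_le_realLpNorm two_pos (fun k => ‖v k‖) k
    rwa [abs_norm] at this
  · have h1 : (1 : ℝ≥0∞) ≤ r := Fact.out
    have hr0 : 0 < r.toReal := ENNReal.toReal_pos (zero_lt_one.trans_le h1).ne' hrt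
    rw [norm_eq_realLpNorm hrt]
    rcases le_total 2 r.toReal with h2 | h2
    · exact (realLpNorm_anti two_pos h2 _).trans hmain
    · refine (realLpNorm_le_card_rpow_mul hr0 h2 _).trans ?_
      rw [Fintype.card_fin]
      refine mul_le_mul_of_nonneg_right
        (Real.rpow_le_rpow_of_exponent_le hNr (le_trans (le_of_eq ?_) (le_max_right _ _)))
        (realLpNorm_nonneg _ _)
      norm_num

/-- Evaluating `γ` at the conjugates of its own coefficients gives `s²`, where `s` is their `ℓ_2`
norm, while that vector has `ℓ_r` norm at most `N ^ inclusionExponent r * s`. -/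
lemma sqrt_sum_sq_norm_apply_single_le (hN : 1 ≤ N)
    (γ : PiLp r (fun _ : Fin N => 𝕜) →L[𝕜] 𝕜) (hγ : ‖γ‖ ≤ 1) :
    √(∑ k, ‖γ (WithLp.toLp r (Pi.single k 1))‖ ^ 2) ≤ (N : ℝ) ^ inclusionExponent r := by
  set z : Fin N → 𝕜 := fun k => γ (WithLp.toLp r (Pi.single k 1)) with hz
  set s := √(∑ k, ‖z k‖ ^ 2) with hs
  have hs0 : 0 ≤ s := Real.sqrt_nonneg _
  have hs2 : s ^ 2 = ∑ k, ‖z k‖ ^ 2 := Real.sq_sqrt (by positivity)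
  set v : PiLp r (fun _ : Fin N => 𝕜) := WithLp.toLp r (fun k => starRingEnd 𝕜 (z k)) with hv
  have hsum : v = ∑ k, starRingEnd 𝕜 (z k) •
      (WithLp.toLp r (Pi.single k (1 : 𝕜)) : PiLp r (fun _ : Fin N => 𝕜)) := by
    ext l
    simp [hv, Pi.single_apply]
  have hγv : γ v = ((s ^ 2 : ℝ) : 𝕜) := by
    rw [hsum, map_sum, hs2]
    push_cast
    refine Finset.sum_congr rfl fun k _ => ?_
    rw [map_smul, smul_eq_mul, RCLike.conj_mul]
  have h1 : s ^ 2 ≤ (N : ℝ) ^ inclusionExponent r * s := by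
    have h2 := (γ.le_of_opNorm_le hγ v).trans_eq (one_mul _)
    rw [hγv, RCLike.norm_ofReal, abs_of_nonneg (sq_nonneg s)] at h2
    refine h2.trans ((norm_toLp_le hN _).trans (le_of_eq ?_))
    rw [realLpNorm_two]
    simp only [RCLike.norm_conj]
    rfl
  rcases hs0.eq_or_lt with h0 | h0
  · rw [← h0]; positivity
  · nlinarith

/-- The easy half of Khinchin: Cauchy-Schwarz over the signs and the exact second moment. -/
lemma sum_norm_apply_signVector_le (hN : 1 ≤ N)
    (γ : PiLp r (fun _ : Fin N => 𝕜) →L[𝕜] 𝕜) (hγ : ‖γ‖ ≤ 1) :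
    ∑ e : Fin N → Bool, ‖γ (signVector 𝕜 r e)‖ ≤ 2 ^ N * (N : ℝ) ^ inclusionExponent r := by
  set z : Fin N → 𝕜 := fun k => γ (WithLp.toLp r (Pi.single k 1)) with hz
  have h1 := sum_norm_signed_sum_sq z
  have h2 := sqrt_sum_sq_norm_apply_single_le hN γ hγ
  have h3 := sq_sum_le_card_mul_sum_sq (s := (Finset.univ : Finset (Fin N → Bool)))
    (f := fun e => ‖∑ k, (boolSign (e k) : 𝕜) * z k‖)
  rw [h1] at h3
  simp only [Finset.card_univ, Fintype.card_pi, Fintype.card_bool, Finset.prod_const,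
    Fintype.card_fin, Nat.cast_pow, Nat.cast_ofNat] at h3
  have h4 : ∀ e : Fin N → Bool, γ (signVector 𝕜 r e) = ∑ k, (boolSign (e k) : 𝕜) * z k :=
    fun e => apply_toLp_eq_sum γ _
  simp_rw [h4]
  have h5 : ∑ e : Fin N → Bool, ‖∑ k, (boolSign (e k) : 𝕜) * z k‖
      ≤ 2 ^ N * √(∑ k, ‖z k‖ ^ 2) := by
    refine abs_le_of_sq_le_sq' ?_ (by positivity) |>.2
    refine h3.trans (le_of_eq ?_)
    rw [mul_pow, Real.sq_sqrt (by positivity)]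
    ring
  exact h5.trans (mul_le_mul_of_nonneg_left h2 (by positivity))

lemma sum_norm_apply_single_le (hN : 1 ≤ N)
    (γ : PiLp r (fun _ : Fin N => 𝕜) →L[𝕜] 𝕜) (hγ : ‖γ‖ ≤ 1) :
    ∑ k, ‖γ (WithLp.toLp r (Pi.single k 1))‖ ≤ (N : ℝ) ^ (1 / r.toReal) := by
  set z : Fin N → 𝕜 := fun k => γ (WithLp.toLp r (Pi.single k 1)) with hz
  choose u hu1 hu using fun k => RCLike.exists_norm_mul_eq_self (z k)
  set v : Fin N → 𝕜 := fun k => starRingEnd 𝕜 (u k) with hv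
  have hvz : ∀ k, v k * z k = (‖z k‖ : 𝕜) := fun k => by
    have h : v k * (u k * (‖z k‖ : 𝕜)) = (‖z k‖ : 𝕜) := by
      simp only [hv]
      rw [← mul_assoc, RCLike.conj_mul, hu1]
      simp
    rwa [hu k] at h
  have h1 : γ (WithLp.toLp r v) = ((∑ k, ‖z k‖ : ℝ) : 𝕜) := by
    rw [apply_toLp_eq_sum]
    push_cast
    exact Finset.sum_congr rfl fun k _ => hvz k
  have hv1 : ∀ k, ‖v k‖ = 1 := fun k => by rw [hv, RCLike.norm_conj, hu1]
  have h2 := (γ.le_of_opNorm_le hγ (WithLp.toLp r v)).trans_eq (one_mul _)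
  rw [h1, RCLike.norm_ofReal, abs_of_nonneg (by positivity)] at h2
  refine h2.trans ?_
  -- For `r = ∞` the exponent `1 / r.toReal` is `1 / 0 = 0`, the correct value.
  by_cases hrt : r = ∞
  · subst hrt
    rw [PiLp.norm_toLp, pi_norm_le_iff_of_nonneg (by positivity)]
    intro k
    simp [hv1]
  · rw [norm_eq_realLpNorm hrt]
    simp [realLpNorm, hv1]

/-- Test families whose weak norms are small force a lower bound on the summing norm. -/
lemma le_mul_prod_of_isMultipleSummingBound (hq : q ≠ ∞) {C : ℝ≥0}
    (hC : IsMultipleSummingBound 1 (diagonalMap 𝕜 m N r q) C) {ι : Type*} [Fintype ι] [Nonempty ι]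
    (x : Fin m → ι → PiLp r (fun _ : Fin N => 𝕜)) (B : Fin m → ℝ) (hB : ∀ i, 0 ≤ B i)
    (hx : ∀ i, ∀ γ : PiLp r (fun _ : Fin N => 𝕜) →L[𝕜] 𝕜, ‖γ‖ ≤ 1 →
      ∑ j, ‖γ (x i j)‖ ≤ Fintype.card ι * B i) {T : ℝ}
    (hT : ∀ j : Fin m → ι, T ≤ realLpNorm q.toReal (fun k => ∏ i, ‖x i (j i) k‖)) :
    T ≤ C * ∏ i, B i := by
  set n := Fintype.card ι with hn
  have hn0 : (0 : ℝ) < n := by exact_mod_cast Fintype.card_pos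
  let φ : Fin n ≃ ι := (Fintype.equivFin ι).symm
  have h1 := hC (fun _ => n) (fun i j => x i (φ j))
  simp only [ENNReal.rpow_one, div_one] at h1
  have h2 : ∀ i, weakSeqNorm 𝕜 1 (fun j => x i (φ j)) ≤ ENNReal.ofReal (n * B i) := by
    intro i
    refine iSup₂_le fun γ hγ => ?_
    simp only [ENNReal.rpow_one, div_one]
    rw [φ.sum_comp (fun j => ‖γ (x i j)‖ₑ)]
    simp_rw [← ofReal_norm]
    rw [← ENNReal.ofReal_sum_of_nonneg (fun _ _ => norm_nonneg _)]
    exact ENNReal.ofReal_le_ofReal (hx i γ hγ)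
  have h3 : ENNReal.ofReal ((n : ℝ) ^ m * T)
      ≤ ∑ j : Fin m → Fin n, ‖diagonalMap 𝕜 m N r q (fun i => x i (φ (j i)))‖ₑ := by
    simp_rw [← ofReal_norm, norm_diagonalMap hq]
    rw [← ENNReal.ofReal_sum_of_nonneg (fun _ _ => realLpNorm_nonneg _ _)]
    refine ENNReal.ofReal_le_ofReal ?_
    have := Finset.card_nsmul_le_sum Finset.univ
      (fun j : Fin m → Fin n => realLpNorm q.toReal (fun k => ∏ i, ‖x i (φ (j i)) k‖)) T
      (fun j _ => hT fun i => φ (j i))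
    simpa using this
  have h4 : (C : ℝ≥0∞) * ∏ i, weakSeqNorm 𝕜 1 (fun j => x i (φ j))
      ≤ ENNReal.ofReal (C * ∏ i, ((n : ℝ) * B i)) := by
    rw [ENNReal.ofReal_mul C.coe_nonneg, ENNReal.ofReal_prod_of_nonneg
      (fun i _ => mul_nonneg hn0.le (hB i)), ENNReal.ofReal_coe_nnreal]
    gcongr with i
    exact h2 i
  have h5 := (ENNReal.ofReal_le_ofReal_iff (mul_nonneg C.coe_nonneg (Finset.prod_nonneg
    fun i _ => mul_nonneg hn0.le (hB i)))).1 (h3.trans (h1.trans h4))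
  rw [Finset.prod_mul_distrib, Finset.prod_const, Finset.card_univ, Fintype.card_fin] at h5
  refine le_of_mul_le_mul_left (h5.trans (le_of_eq ?_)) (pow_pos hn0 m)
  ring

/-- Lower bound obtained from sign vectors in all variables. -/
lemma rpow_inv_le_of_isMultipleSummingBound (hq : q ≠ ∞) (hN : 1 ≤ N) {C : ℝ≥0}
    (hC : IsMultipleSummingBound 1 (diagonalMap 𝕜 m N r q) C) :
    (N : ℝ) ^ (q.toReal)⁻¹ ≤ C * ((N : ℝ) ^ inclusionExponent r) ^ m := by
  have h := le_mul_prod_of_isMultipleSummingBound hq hC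
    (fun _ => signVector 𝕜 r) (fun _ => (N : ℝ) ^ inclusionExponent r) (fun _ => by positivity)
    (fun i γ hγ => (sum_norm_apply_signVector_le hN γ hγ).trans (le_of_eq (by simp)))
    (T := (N : ℝ) ^ (q.toReal)⁻¹) (fun j => le_of_eq (by
      simp [norm_signVector_apply, realLpNorm]))
  simpa using h

/-- Lower bound obtained from unit vectors in the first variable and sign vectors in the others. -/
lemma one_le_of_isMultipleSummingBound (hq : q ≠ ∞) (hm : 1 ≤ m) (hN : 1 ≤ N)
    (hr : inclusionExponent r = 0) {C : ℝ≥0}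
    (hC : IsMultipleSummingBound 1 (diagonalMap 𝕜 m N r q) C) :
    1 ≤ C * (N : ℝ) ^ (1 / r.toReal - 1) := by
  have hNr : (1 : ℝ) ≤ N := by exact_mod_cast hN
  have hN0 : (0 : ℝ) < N := by linarith
  have : Nonempty (Fin N) := ⟨⟨0, hN⟩⟩
  have hq0 : 0 < q.toReal := ENNReal.toReal_pos (zero_lt_one.trans_le Fact.out).ne' hq
  set i₀ : Fin m := ⟨0, hm⟩ with hi₀
  -- All variables share one index set, so each family is repeated; normalizing by the cardinality
  -- makes this harmless. The unit vectors then contribute `N ^ (1/r) / N`.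
  have h := le_mul_prod_of_isMultipleSummingBound hq hC (ι := Fin N × (Fin N → Bool))
    (fun i p => if i = i₀ then WithLp.toLp r (Pi.single p.1 1) else signVector 𝕜 r p.2)
    (fun i => if i = i₀ then (N : ℝ) ^ (1 / r.toReal - 1) else 1)
    (fun i => by split_ifs <;> positivity)
    (fun i γ hγ => by
      rw [Fintype.sum_prod_type, Fintype.card_prod]
      split_ifs with hi
      · simp only [Finset.sum_const, Finset.card_univ, nsmul_eq_mul, Fintype.card_fin]
        rw [← Finset.mul_sum]
        refine (mul_le_mul_of_nonneg_left (sum_norm_apply_single_le hN γ hγ)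
          (by positivity)).trans (le_of_eq ?_)
        rw [Real.rpow_sub_one hN0.ne']
        push_cast
        field_simp
      · have h1 := sum_norm_apply_signVector_le hN γ hγ
        rw [hr, Real.rpow_zero, mul_one] at h1
        simp only [Finset.sum_const, Finset.card_univ, nsmul_eq_mul, Fintype.card_fin,
          Fintype.card_pi, Fintype.card_bool, Finset.prod_const]
        push_cast
        nlinarith)
    (T := 1) (fun j => by
      have h2 := abs_le_realLpNorm hq0 (fun k => ∏ i, ‖(if i = i₀ then
        (WithLp.toLp r (Pi.single (j i).1 1) : PiLp r (fun _ : Fin N => 𝕜))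
        else signVector 𝕜 r (j i).2) k‖) (j i₀).1
      refine le_trans (le_of_eq ?_) h2
      rw [Finset.prod_eq_one, abs_one]
      intro i _
      split_ifs with hi
      · subst hi
        simp
      · exact norm_signVector_apply _ _)
  simpa using h

end lower

/-! ### From norm bounds to the limit order -/

section limit

variable {𝕜 : Type*} [RCLike 𝕜] {m : ℕ} {r q : ℝ≥0∞} [Fact (1 ≤ r)] [Fact (1 ≤ q)]

lemma limitOrder_nonneg : 0 ≤ limitOrder 𝕜 1 m r q := by
  refine le_sInf ?_
  rintro _ ⟨l, ⟨hl, -⟩, rfl⟩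
  exact EReal.coe_nonneg.2 hl

lemma limitOrder_le_of_forall_pos {L : ℝ} (hL : 0 ≤ L)
    (h : ∀ ε : ℝ, 0 < ε → ∃ C : ℝ, 0 < C ∧ ∀ N : ℕ, 1 ≤ N →
      multipleSummingNorm 1 (diagonalMap 𝕜 m N r q) ≤ ENNReal.ofReal (C * (N : ℝ) ^ (L + ε))) :
    limitOrder 𝕜 1 m r q ≤ (L : EReal) := by
  refine le_of_forall_gt_imp_ge_of_dense fun a ha => ?_
  obtain ⟨b, hb1, hb2⟩ := EReal.lt_iff_exists_real_btwn.1 ha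
  refine le_trans (sInf_le ⟨b, ⟨?_, ?_⟩, rfl⟩) hb2.le
  · exact hL.trans (EReal.coe_lt_coe_iff.1 hb1).le
  · have := h (b - L) (sub_pos.2 (EReal.coe_lt_coe_iff.1 hb1))
    simpa using this

/-- If `l < L` were admissible, `N ^ (L - l)` would stay bounded. -/
lemma le_limitOrder {L : ℝ}
    (h : ∀ N : ℕ, 1 ≤ N → ∀ C : ℝ≥0, IsMultipleSummingBound 1 (diagonalMap 𝕜 m N r q) C →
      (N : ℝ) ^ L ≤ C) :
    (L : EReal) ≤ limitOrder 𝕜 1 m r q := by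
  refine le_sInf ?_
  rintro _ ⟨l, ⟨-, C, hC, hl⟩, rfl⟩
  rw [EReal.coe_le_coe_iff]
  have h1 : ∀ N : ℕ, 1 ≤ N → (N : ℝ) ^ L ≤ C * (N : ℝ) ^ l := by
    intro N hN
    have h2 : ENNReal.ofReal ((N : ℝ) ^ L) ≤ multipleSummingNorm 1 (diagonalMap 𝕜 m N r q) := by
      refine le_iInf₂ fun C' hC' => ?_
      rw [← ENNReal.ofReal_coe_nnreal]
      exact ENNReal.ofReal_le_ofReal (h N hN C' hC')
    exact (ENNReal.ofReal_le_ofReal_iff (by positivity)).1 (h2.trans (hl N hN))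
  by_contra! hlt
  have h3 := ((tendsto_rpow_atTop (sub_pos.2 hlt)).comp
    tendsto_natCast_atTop_atTop).eventually_gt_atTop C
  obtain ⟨N, hN1, hN2⟩ := (h3.and (Filter.eventually_ge_atTop 1)).exists
  have hN0 : (0 : ℝ) < N := by exact_mod_cast hN2
  have h4 := h1 N hN2
  rw [show L = (L - l) + l by ring, Real.rpow_add hN0] at h4
  exact absurd (le_of_mul_le_mul_right h4 (by positivity)) (not_le.2 hN1)

lemma sum_inv_le_one_add_log {n : ℕ} :
    ∑ v : Fin n, ((v : ℕ) + 1 : ℝ)⁻¹ ≤ 1 + Real.log n := by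
  have h := harmonic_le_one_add_log n
  rw [harmonic, ← Fin.sum_univ_eq_sum_range (fun i => ((i + 1 : ℕ) : ℚ)⁻¹)] at h
  push_cast at h
  exact h

/-- Powers of logarithms are absorbed by arbitrarily small powers. -/
lemma exists_log_factor_le (m : ℕ) {ρ : ℝ} (hρ : 1 ≤ ρ) {ε : ℝ} (hε : 0 < ε) :
    ∃ C : ℝ, 0 < C ∧ ∀ N : ℕ, 1 ≤ N →
      (27 / 5 * (∑ v : Fin (2 * N), ((v : ℕ) + 1 : ℝ)⁻¹) ^ ρ⁻¹) ^ m ≤ C * (N : ℝ) ^ ε := by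
  -- Then `m * s ≤ ε`, also for `m = 0`.
  set s : ℝ := ε / (m + 1) with hs
  have hs0 : 0 < s := by positivity
  refine ⟨(27 / 5 * (1 + 2 ^ s / s)) ^ m, by positivity, fun N hN => ?_⟩
  have hNr : (1 : ℝ) ≤ N := by exact_mod_cast hN
  set H := ∑ v : Fin (2 * N), ((v : ℕ) + 1 : ℝ)⁻¹ with hH
  have h1 : 1 ≤ H := by
    have := Finset.single_le_sum (f := fun v : Fin (2 * N) => ((v : ℕ) + 1 : ℝ)⁻¹)
      (fun _ _ => by positivity) (Finset.mem_univ ⟨0, by omega⟩)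
    simpa using this
  have h2 : H ≤ (1 + 2 ^ s / s) * (N : ℝ) ^ s := by
    have h3 : Real.log (2 * N : ℕ) ≤ (2 * N : ℕ) ^ s / s :=
      Real.log_le_rpow_div (Nat.cast_nonneg _) hs0
    have h4 : ((2 * N : ℕ) : ℝ) ^ s = 2 ^ s * (N : ℝ) ^ s := by
      push_cast
      exact Real.mul_rpow two_pos.le (Nat.cast_nonneg _)
    have h5 : 1 ≤ (N : ℝ) ^ s := Real.one_le_rpow hNr hs0.le
    have h6 : H ≤ 1 + Real.log (2 * N : ℕ) := sum_inv_le_one_add_log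
    rw [h4] at h3
    calc H ≤ 1 + 2 ^ s * (N : ℝ) ^ s / s := by linarith
      _ ≤ (N : ℝ) ^ s + 2 ^ s * (N : ℝ) ^ s / s := by linarith
      _ = _ := by ring
  have h7 : H ^ ρ⁻¹ ≤ H := by
    conv_rhs => rw [← Real.rpow_one H]
    exact Real.rpow_le_rpow_of_exponent_le h1 (inv_le_one_of_one_le₀ hρ)
  have h8 : 27 / 5 * H ^ ρ⁻¹ ≤ 27 / 5 * (1 + 2 ^ s / s) * (N : ℝ) ^ s := by linarith
  refine (pow_le_pow_left₀ (by positivity) h8 m).trans ?_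
  rw [mul_pow]
  refine mul_le_mul_of_nonneg_left ?_ (by positivity)
  rw [← Real.rpow_natCast, ← Real.rpow_mul (by positivity)]
  refine Real.rpow_le_rpow_of_exponent_le hNr ?_
  rw [hs, div_mul_eq_mul_div, div_le_iff₀ (by positivity)]
  nlinarith

/-- The limit order for `r ≥ 2`. -/
lemma limitOrder_of_conjugate_le_two (hm : 1 ≤ m) {r' : ℝ≥0∞}
    (hr : ENNReal.HolderConjugate r r') (hr2 : r' ≤ 2) (hq : q ≤ 2) :
    limitOrder 𝕜 1 m r q = ((max (q.toReal)⁻¹ (r'.toReal)⁻¹ : ℝ) : EReal) := by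
  have hqt : q ≠ ∞ := ne_top_of_le_ne_top (by simp) hq
  have hr't : r' ≠ ∞ := ne_top_of_le_ne_top (by simp) hr2
  have hinv := ENNReal.HolderConjugate.inv_add_inv_eq_one r r'
  have hr'1 : 1 ≤ r' := by
    rw [← ENNReal.inv_le_one]
    exact hinv ▸ le_add_self
  have hρ : 1 ≤ r'.toReal := by simpa using ENNReal.toReal_mono hr't hr'1
  have hρ2 : r'.toReal ≤ 2 := by simpa using ENNReal.toReal_mono (by simp) hr2
  have hr1 : r ≠ 1 := by
    rintro rfl
    simp at hinv
    exact hr't hinv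
  have hreal : (r.toReal)⁻¹ + (r'.toReal)⁻¹ = 1 := by
    have := congrArg ENNReal.toReal hinv
    rwa [ENNReal.toReal_add (by simpa using (zero_lt_one.trans_le (Fact.out : 1 ≤ r)).ne')
      (by simpa using (zero_lt_one.trans_le hr'1).ne'),
      ENNReal.toReal_inv, ENNReal.toReal_inv, ENNReal.toReal_one] at this
  have hincl : inclusionExponent r = 0 := by
    have : (2 : ℝ)⁻¹ ≤ (r'.toReal)⁻¹ := inv_anti₀ (by linarith) hρ2
    refine max_eq_left ?_
    rw [one_div]
    linarith
  refine le_antisymm ?_ ?_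
  · refine limitOrder_le_of_forall_pos (by positivity) fun ε hε => ?_
    obtain ⟨C, hC, h⟩ := exists_log_factor_le m hρ hε
    refine ⟨C, hC, fun N hN => ?_⟩
    refine (multipleSummingNorm_diagonalMap_le_of_two_le hr hr1 hρ hqt hN).trans
      (ENNReal.ofReal_le_ofReal ?_)
    have hN0 : (0 : ℝ) < N := by exact_mod_cast hN
    rw [Real.rpow_add hN0]
    refine (mul_le_mul_of_nonneg_right (h N hN) (by positivity)).trans (le_of_eq (by ring))
  · refine le_limitOrder fun N hN C hC => ?_
    have hN0 : (0 : ℝ) < N := by exact_mod_cast hN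
    rcases max_choice (q.toReal)⁻¹ (r'.toReal)⁻¹ with h | h <;> rw [h]
    · have := rpow_inv_le_of_isMultipleSummingBound hqt hN hC
      rwa [hincl, Real.rpow_zero, one_pow, mul_one] at this
    · have := one_le_of_isMultipleSummingBound hqt hm hN hincl hC
      rw [show 1 / r.toReal - 1 = -(r'.toReal)⁻¹ by rw [one_div]; linarith,
        Real.rpow_neg hN0.le, ← div_eq_mul_inv, le_div_iff₀ (by positivity), one_mul] at this
      exact this

/-- The limit order for `1 ≤ r < 2`. -/
lemma limitOrder_of_lt_two (hm : 1 ≤ m) {r' : ℝ≥0∞}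
    (hr : ENNReal.HolderConjugate r r') (hr2 : r < 2) (hq : q ≤ 2) :
    limitOrder 𝕜 1 m r q
      = ((max 0 ((q.toReal)⁻¹ - m * (1 / r.toReal - 1 / 2)) : ℝ) : EReal) := by
  have hqt : q ≠ ∞ := ne_top_of_le_ne_top (by simp) hq
  have hrt : r ≠ ∞ := (hr2.trans (by simp)).ne
  have hr0 : 0 < r.toReal :=
    ENNReal.toReal_pos (zero_lt_one.trans_le (Fact.out : 1 ≤ r)).ne' hrt
  have hδ : 0 < 1 / r.toReal - 1 / 2 := by
    rw [sub_pos]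
    exact one_div_lt_one_div_of_lt hr0
      (by simpa using (ENNReal.toReal_lt_toReal hrt (by simp)).2 hr2)
  have hincl : inclusionExponent r = 1 / r.toReal - 1 / 2 := max_eq_right hδ.le
  refine le_antisymm ?_ ?_
  · refine limitOrder_le_of_forall_pos (le_max_left _ _) fun ε hε => ⟨2 ^ m, by positivity,
      fun N hN => ?_⟩
    refine (multipleSummingNorm_diagonalMap_le_of_lt_two hm hr hr2 hq hN).trans
      (ENNReal.ofReal_le_ofReal ?_)
    refine mul_le_mul_of_nonneg_left ?_ (by positivity)
    exact Real.rpow_le_rpow_of_exponent_le (by exact_mod_cast hN) (by linarith)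
  · rcases max_choice 0 ((q.toReal)⁻¹ - m * (1 / r.toReal - 1 / 2)) with h | h <;> rw [h]
    · exact limitOrder_nonneg
    · refine le_limitOrder fun N hN C hC => ?_
      have hN0 : (0 : ℝ) < N := by exact_mod_cast hN
      have h1 := rpow_inv_le_of_isMultipleSummingBound hqt hN hC
      rw [hincl, ← Real.rpow_natCast, ← Real.rpow_mul hN0.le] at h1
      rw [Real.rpow_sub hN0, div_le_iff₀ (by positivity), mul_comm (m : ℝ)]
      exact h1

end limit

/-! ### The case distinction -/

/-- The case distinction of the limit order in terms of real exponents. -/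
lemma threshold_lt_iff {m : ℕ} (hm : 1 ≤ m) {r q : ℝ≥0∞} (hr : r ≠ ∞) (hr0 : r ≠ 0) (hq : q ≠ ∞)
    (hq0 : q ≠ 0) :
    2 * m * q / (2 + m * q) < r ↔ 0 < (q.toReal)⁻¹ - m * (1 / r.toReal - 1 / 2) := by
  have hmr : (0 : ℝ) < m := by exact_mod_cast hm
  have hrr := ENNReal.toReal_pos hr0 hr
  have hqr := ENNReal.toReal_pos hq0 hq
  have hmq : (m : ℝ≥0∞) * q ≠ ∞ := ENNReal.mul_ne_top (by simp) hq
  have hfin : 2 * m * q / (2 + m * q) ≠ ∞ :=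
    ENNReal.div_ne_top (ENNReal.mul_ne_top (ENNReal.mul_ne_top (by simp) (by simp)) hq) (by simp)
  rw [← ENNReal.toReal_lt_toReal hfin hr, ENNReal.toReal_div,
    ENNReal.toReal_add (by simp) hmq]
  simp only [ENNReal.toReal_mul, ENNReal.toReal_ofNat, ENNReal.toReal_natCast]
  rw [div_lt_iff₀ (by positivity)]
  have : (q.toReal)⁻¹ - m * (1 / r.toReal - 1 / 2)
      = (r.toReal * (2 + m * q.toReal) - 2 * m * q.toReal) / (2 * q.toReal * r.toReal) := by
    field_simp
    ring
  rw [this, div_pos_iff_of_pos_right (by positivity), sub_pos]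

theorem proposition1p7 (𝕜 : Type*) [RCLike 𝕜] (m : ℕ) (hm : 1 ≤ m)
    (r r' q : ℝ≥0∞) [Fact (1 ≤ r)] [Fact (1 ≤ q)] (hr : ENNReal.HolderConjugate r r') :
    (q ≤ r' → r' ≤ 2 →
      limitOrder 𝕜 1 m r q = ((1 / q.toReal : ℝ) : EReal)) ∧
    (r' ≤ q → q ≤ 2 →
      limitOrder 𝕜 1 m r q = ((1 / r'.toReal : ℝ) : EReal)) ∧
    (2 * m * q / (2 + m * q) < r → r ≤ 2 → q ≤ 2 →
      limitOrder 𝕜 1 m r q =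
        ((1 / q.toReal + (m : ℝ) / 2 - (m : ℝ) / r.toReal : ℝ) : EReal)) ∧
    (r ≤ 2 * m * q / (2 + m * q) → q ≤ 2 →
      limitOrder 𝕜 1 m r q = 0) := by
  have hq1 : 1 ≤ q := Fact.out
  have hr1 : 1 ≤ r := Fact.out
  have hq0 : q ≠ 0 := (zero_lt_one.trans_le hq1).ne'
  have hr0 : r ≠ 0 := (zero_lt_one.trans_le hr1).ne'
  have hinv := ENNReal.HolderConjugate.inv_add_inv_eq_one r r'
  have hr'1 : 1 ≤ r' := by
    rw [← ENNReal.inv_le_one]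
    exact hinv ▸ le_add_self
  have hr'0 : r' ≠ 0 := (zero_lt_one.trans_le hr'1).ne'
  refine ⟨fun h1 h2 => ?_, fun h1 h2 => ?_, fun h1 h2 h3 => ?_, fun h1 h2 => ?_⟩
  · have hr't : r' ≠ ∞ := ne_top_of_le_ne_top (by simp) h2
    have hqt : q ≠ ∞ := ne_top_of_le_ne_top hr't h1
    rw [limitOrder_of_conjugate_le_two hm hr h2 (h1.trans h2), max_eq_left, one_div]
    exact inv_anti₀ (ENNReal.toReal_pos hq0 hqt) (ENNReal.toReal_mono hr't h1)
  · have hqt : q ≠ ∞ := ne_top_of_le_ne_top (by simp) h2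
    have hr't : r' ≠ ∞ := ne_top_of_le_ne_top hqt h1
    rw [limitOrder_of_conjugate_le_two hm hr (h1.trans h2) h2, max_eq_right, one_div]
    exact inv_anti₀ (ENNReal.toReal_pos hr'0 hr't) (ENNReal.toReal_mono hqt h1)
  · have hqt : q ≠ ∞ := ne_top_of_le_ne_top (by simp) h3
    have hrt : r ≠ ∞ := ne_top_of_le_ne_top (by simp) h2
    -- At `r = 2` the exponent `1/δ` degenerates, so this endpoint is taken from the case `r' ≤ 2`,
    -- where `m/2 - m/r` vanishes.
    rcases h2.eq_or_lt with rfl | hlt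
    · have hr' : r' = 2 := by
        have h4 : r'⁻¹ = 1 - 2⁻¹ := ENNReal.eq_sub_of_add_eq (by simp) (by rw [add_comm, hinv])
        rw [ENNReal.one_sub_inv_two] at h4
        exact inv_injective h4
      subst hr'
      rw [limitOrder_of_conjugate_le_two hm hr le_rfl h3, max_eq_left]
      · congr 1
        simp
      · exact inv_anti₀ (ENNReal.toReal_pos hq0 hqt) (ENNReal.toReal_mono (by simp) h3)
    · rw [limitOrder_of_lt_two hm hr hlt h3,
        max_eq_right ((threshold_lt_iff hm hrt hr0 hqt hq0).1 h1).le]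
      congr 1
      ring
  · have hqt : q ≠ ∞ := ne_top_of_le_ne_top (by simp) h2
    have hr2 : r < 2 := by
      refine h1.trans_lt ?_
      -- The threshold lies below `2`: the criterion at `r = 2` reads `0 < 1/q`.
      rw [threshold_lt_iff hm (by simp) (by simp) hqt hq0]
      have := inv_pos.2 (ENNReal.toReal_pos hq0 hqt)
      simpa using this
    have hrt : r ≠ ∞ := (hr2.trans (by simp)).ne
    rw [limitOrder_of_lt_two hm hr hr2 h2, max_eq_left, EReal.coe_zero]
    exact not_lt.1 fun h => not_lt.2 h1 ((threshold_lt_iff hm hrt hr0 hqt hq0).2 h)
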